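/- **Conventions.** Let $\mathcal F$ be a set of function symbols of fixed arity, $\mathcal V$ an infinite set of variables, and $\mathrm T(\mathcal F,\mathcal V)$ the set of terms; substitutions have finite domain. Write $\mathcal V(t)$ for the set of variables occurring in $t$, $t/p$ for the subterm of $t$ at position $p$, $t[s]_p$ for the result of replacing it by $s$, and $\epsilon$ for the root position. Positions are *parallel* if none is a prefix of another. For a set $V$ of positions of $t$, put $\mathcal V_V(t)=\bigcup_{p\in V}\mathcal V(t/p)$. A *rewrite rule* $l\to r$ is an equation with $l\notin\mathcal V$ and $\mathcal V(r)\subseteq\mathcal V(l)$; it is *left-linear* if every variable occurs at most once in $l$. Equations are identified modulo renaming of variables. A *TRS* is a finite set of rewrite rules; it is left-linear if all its rules are. For a set $\mathcal E$ of equations, $\mathcal E^{-1}=\{r\approx l\mid l\approx r\in\mathcal E\}$; $s\to_{\mathcal E}t$ means that $s/p=l\theta$ and $t=s[r\theta]_p$ for some $l\approx r\in\mathcal E$, position $p$ and substitution $\theta$. We write $s\Vert\!\!\!\to_{V,\mathcal E}t$ if $V$ is a (possibly empty) finite set of parallel positions of $s$ and $t$ arises from $s$ by replacing simultaneously, for every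 $p\in V$, the subterm $s/p=l_p\theta_p$ by $r_p\theta_p$, where $l_p\approx r_p\in\mathcal E$; and $s\Vert\!\!\!\to_{\mathcal E}t$ if this holds for some $V$. Reversed arrows denote inverse relations, ${}^*$ the reflexive transitive closure, and $\circ$ composition from left to right. $\mathcal P$ is *reversible* if $s\to_{\mathcal P}t$ implies $t\to^*_{\mathcal P}s$; $\mathcal S$ is *terminating relative to* $\mathcal P'$ if there is no infinite chain $a_0\,R\,a_1\,R\cdots$ for $R={\to_{\mathcal S}}\circ{\to^*_{\mathcal P'}}$; a TRS $\mathcal R$ is *confluent* if ${\gets^*_{\mathcal R}}\circ{\to^*_{\mathcal R}}\subseteq{\to^*_{\mathcal R}}\circ{\gets^*_{\mathcal R}}$. **Critical pairs.** Let $l_1\to r_1$ be in $\mathcal R$ and $l_2\to r_2$ in $\mathcal Q$, renamed to have no variable in common, let $p$ be a position of $l_2$ with $l_2/p\notin\mathcal V$, and let $\sigma$ be a most general unifier of $l_1$ and $l_2/p$; the case $p=\epsilon$ is excluded if the two rules are equal up to renaming. Then $\langle l_2[r_1]_p\sigma,\ r_2\sigma\rangle\in\mathrm{CP}(\mathcal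 R,\mathcal Q)$. Let $l_1\to r_1,\dots,l_n\to r_n$ ($n\ge1$) be in $\mathcal R$ and $l'\to r'$ in $\mathcal Q$, renamed to have mutually disjoint variables, let $p_1,\dots,p_n\ne\epsilon$ be parallel positions of $l'$ with $l'/p_i\notin\mathcal V$, and let $\sigma$ be a most general unifier of $\{l_i\approx l'/p_i\mid 1\le i\le n\}$. Then $\langle l'[r_1,\dots,r_n]_{p_1,\dots,p_n}\sigma,\ r'\sigma\rangle_X\in\mathrm{PCP}_{\mathrm{in}}(\mathcal R,\mathcal Q)$ with $X=\mathcal V_{\{p_1,\dots,p_n\}}(l'\sigma)$. **Theorem 3.15.** Let $\mathcal P,\mathcal S,\mathcal P'$ be TRSs such that $\mathcal S$ is left-linear, $\mathcal P$ is reversible, $\mathcal P'\subseteq\mathcal P\cup\mathcal P^{-1}$, and $\mathcal S$ is terminating relative to $\mathcal P'$. Suppose: (i) $\mathrm{CP}(\mathcal S,\mathcal S)\subseteq{\to^*_{\mathcal S\cup\mathcal P'}}\circ{\gets\!\!\!\Vert_{\mathcal P\cup\mathcal P^{-1}}}\circ{\gets^*_{\mathcal S\cup\mathcal P'}}$; (ii)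 for every $\langle u,v\rangle_X\in\mathrm{PCP}_{\mathrm{in}}(\mathcal P\cup\mathcal P^{-1},\mathcal S)$ there are a term $u'$ and a set $V$ of positions with $\mathcal V_V(u')\subseteq X$ such that $u=u'\gets\!\!\!\Vert_{V,\mathcal P\cup\mathcal P^{-1}}\circ\gets^*_{\mathcal S\cup\mathcal P'}v$ or $u\to_{\mathcal S}\circ\to^*_{\mathcal S\cup\mathcal P'}u'\gets\!\!\!\Vert_{V,\mathcal P\cup\mathcal P^{-1}}\circ\gets^*_{\mathcal S\cup\mathcal P'}v$; (iii) $\mathrm{CP}(\mathcal S,\mathcal P\cup\mathcal P^{-1})\subseteq({\to^*_{\mathcal S\cup\mathcal P'}}\circ{\Vert\!\!\!\to_{\mathcal P\cup\mathcal P^{-1}}})\cup({\to^*_{\mathcal S\cup\mathcal P'}}\circ{\Vert\!\!\!\to_{\mathcal P\cup\mathcal P^{-1}}}\circ{\gets^*_{\mathcal S\cup\mathcal P'}}\circ{\gets_{\mathcal S}})$. Then $\mathcal S\cup\mathcal P$ is confluent. -/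

import Mathlib

universe u w v

namespace TermRewriting

open FirstOrder FirstOrder.Language

/-! First-order terms: `L.Functions n` is the set of function symbols of arity `n` (the relation
symbols of `L` play no role), `V` is the set of variables, and `L.Term V` is `T(F, V)`. -/

variable {L : FirstOrder.Language.{u, w}} {V : Type v}

/-- Positions are finite sequences of argument numbers; the arguments of a function symbol of
arity `n` are numbered `0, …, n - 1`. The empty position is `[]`. -/
abbrev Pos : Type := List ℕ

/-- The set of variables occurring in a term. -/
def vars : L.Term V → Set V
  | .var x => {x}
  | .func _ ts => ⋃ i, vars (ts i)

/-- The subterm `t/p`; the value is `none` exactly when `p` is not a position of `t`. -/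
def subtermAt : L.Term V → Pos → Option (L.Term V)
  | t, [] => some t
  | .var _, _ :: _ => none
  | .func (l := n) _ ts, i :: p => if h : i < n then subtermAt (ts ⟨i, h⟩) p else none

/-- Simultaneous replacement: going down from the root, the subterm at the first position `p` met
on a branch with `w p = some s` is replaced by `s`. -/
def replaceAll : L.Term V → (Pos → Option (L.Term V)) → L.Term V
  | .var x, w => (w []).getD (.var x)
  | .func f ts, w =>
      (w []).getD (.func f fun i => replaceAll (ts i) fun p => w (i.val :: p))

/-- `t[s p]_{p ∈ U}`: the subterm of `t` at each position `p ∈ U` is replaced by `s p`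
(used for sets `U` of parallel positions of `t`). -/
def replaceAt (t : L.Term V) (U : Finset Pos) (s : Pos → L.Term V) : L.Term V :=
  replaceAll t fun p => if p ∈ U then some (s p) else none

/-- The positions in `U` are pairwise parallel: none is a prefix of another one. -/
def ParallelPos (U : Finset Pos) : Prop :=
  ∀ p ∈ U, ∀ q ∈ U, p ≠ q → ¬ p <+: q

/-- `V_U(t)`: the variables of the subterms of `t` at the positions in `U`. -/
def varsAt (t : L.Term V) (U : Finset Pos) : Set V :=
  {x | ∃ p ∈ U, ∃ s, subtermAt t p = some s ∧ x ∈ vars s}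

/-- A term is linear if no variable occurs at two different positions. -/
def LinearTerm (t : L.Term V) : Prop :=
  ∀ (x : V) (p q : Pos), subtermAt t p = some (.var x) → subtermAt t q = some (.var x) → p = q

/-- Substitutions: maps from variables to terms with finite domain. -/
structure Subst (L : FirstOrder.Language.{u, w}) (V : Type v) where
  toFun : V → L.Term V
  finite_dom : {x | toFun x ≠ Term.var x}.Finite

/-- The term `tσ`. -/
def Subst.app (σ : Subst L V) (t : L.Term V) : L.Term V :=
  t.subst σ.toFun

/-- Equations `lhs ≈ rhs`; rewrite rules are special equations. -/
@[ext]
structure Equation (L : FirstOrder.Language.{u, w}) (V : Type v) where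
  lhs : L.Term V
  rhs : L.Term V

/-- The variables of an equation. -/
def Equation.vars (e : Equation L V) : Set V :=
  TermRewriting.vars e.lhs ∪ TermRewriting.vars e.rhs

/-- The reversed equation `rhs ≈ lhs`. -/
def Equation.swap (e : Equation L V) : Equation L V := ⟨e.rhs, e.lhs⟩

/-- Equality of equations modulo renaming of variables. -/
def Equation.Variant (e e' : Equation L V) : Prop :=
  ∃ π : Equiv.Perm V, e'.lhs = e.lhs.relabel π ∧ e'.rhs = e.rhs.relabel π

/-- `E⁻¹`. -/
def inverse (E : Set (Equation L V)) : Set (Equation L V) :=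
  {e | e.swap ∈ E}

/-- Membership in a set of equations, where equations are identified modulo renaming. -/
def MemVariant (e : Equation L V) (E : Set (Equation L V)) : Prop :=
  ∃ e₀ ∈ E, e₀.Variant e

/-- Inclusion of sets of equations, where equations are identified modulo renaming. -/
def SubsetVariant (E E' : Set (Equation L V)) : Prop :=
  ∀ e ∈ E, MemVariant e E'

/-- The equation is a rewrite rule: the left-hand side is not a variable and every variable of the
right-hand side occurs in the left-hand side. -/
def Equation.IsRule (e : Equation L V) : Prop :=
  (∀ x : V, e.lhs ≠ .var x) ∧ TermRewriting.vars e.rhs ⊆ TermRewriting.vars e.lhs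

/-- A term rewriting system is a finite set of rewrite rules. -/
def IsTRS (R : Set (Equation L V)) : Prop :=
  R.Finite ∧ ∀ e ∈ R, e.IsRule

def LeftLinear (R : Set (Equation L V)) : Prop :=
  ∀ e ∈ R, LinearTerm e.lhs

/-- One rewrite step `s →_R t`. -/
def Rew (R : Set (Equation L V)) (s t : L.Term V) : Prop :=
  ∃ e ∈ R, ∃ (θ : Subst L V) (p : Pos),
    subtermAt s p = some (θ.app e.lhs) ∧ t = replaceAt s {p} fun _ => θ.app e.rhs

/-- `s →*_R t`. -/
def RewStar (R : Set (Equation L V)) : L.Term V → L.Term V → Prop :=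
  Relation.ReflTransGen (Rew R)

/-- The parallel rewrite step from `s` to `t` at the set `U` of parallel positions of `s`
(`U` may be empty). -/
def ParRewAt (R : Set (Equation L V)) (U : Finset Pos) (s t : L.Term V) : Prop :=
  ParallelPos U ∧
  ∃ (e : Pos → Equation L V) (θ : Pos → Subst L V),
    (∀ p ∈ U, e p ∈ R ∧ subtermAt s p = some ((θ p).app (e p).lhs)) ∧
    t = replaceAt s U fun p => (θ p).app (e p).rhs

/-- A parallel rewrite step from `s` to `t` at some set of positions. -/
def ParRew (R : Set (Equation L V)) (s t : L.Term V) : Prop :=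
  ∃ U : Finset Pos, ParRewAt R U s t

/-- `R` is reversible: `s →_R t` implies `t →*_R s`. -/
def Reversible (R : Set (Equation L V)) : Prop :=
  ∀ s t : L.Term V, Rew R s t → RewStar R t s

/-- `S` is terminating relative to `R`: there is no infinite chain for the composition of `→_S`
followed by `→*_R`. -/
def RelTerminating (S R : Set (Equation L V)) : Prop :=
  WellFounded fun t s : L.Term V => ∃ s', Rew S s s' ∧ RewStar R s' t

def Confluent (R : Set (Equation L V)) : Prop :=
  ∀ s t₁ t₂ : L.Term V, RewStar R s t₁ → RewStar R s t₂ → ∃ t, RewStar R t₁ t ∧ RewStar R t₂ t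

def IsUnifier (σ : Subst L V) (E : Set (Equation L V)) : Prop :=
  ∀ e ∈ E, σ.app e.lhs = σ.app e.rhs

/-- `σ` is a most general unifier of `E`: every unifier of `E` is an instance of `σ`. -/
def IsMGU (σ : Subst L V) (E : Set (Equation L V)) : Prop :=
  IsUnifier σ E ∧
  ∀ τ : Subst L V, IsUnifier τ E → ∃ δ : Subst L V, ∀ x : V, τ.toFun x = δ.app (σ.toFun x)

/-- `⟨u, v⟩ ∈ CP(R, Q)`: the critical pair `⟨l₂[r₁]_p σ, r₂σ⟩` is obtained by an overlap of a rule
`e₁ = (l₁ → r₁)` of `R` on a rule `e₂ = (l₂ → r₂)` of `Q` at a position `p`, the rules being renamed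
so that they have no variable in common. The overlap of a rule on (a variant of) itself at the root
is not considered. Outer (`p = []`) and inner (`p ≠ []`) critical pairs are both included. -/
def IsCriticalPair (R Q : Set (Equation L V)) (u v : L.Term V) : Prop :=
  ∃ (e₁ e₂ : Equation L V) (p : Pos) (s : L.Term V) (σ : Subst L V),
    MemVariant e₁ R ∧ MemVariant e₂ Q ∧ Disjoint e₁.vars e₂.vars ∧
    ¬ (e₁.Variant e₂ ∧ p = []) ∧
    subtermAt e₂.lhs p = some s ∧ (∀ x : V, s ≠ .var x) ∧
    IsMGU σ {⟨e₁.lhs, s⟩} ∧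
    u = σ.app (replaceAt e₂.lhs {p} fun _ => e₁.rhs) ∧ v = σ.app e₂.rhs

/-- The parallel critical pair `⟨u, v⟩_X` is obtained by the parallel-overlap of the rules `e p`
(`p ∈ U`) of `R` on a rule `e'` of `Q` at the nonempty set `U` of parallel positions, all
rules being renamed so that no two of them have a variable in common. The overlap of a rule on
(a variant of) itself at the root is not considered. -/
def IsParallelCriticalPair (R Q : Set (Equation L V)) (U : Finset Pos) (u v : L.Term V)
    (X : Set V) : Prop :=
  U.Nonempty ∧ ParallelPos U ∧
  ∃ (e : Pos → Equation L V) (e' : Equation L V) (σ : Subst L V),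
    (∀ p ∈ U, MemVariant (e p) R) ∧ MemVariant e' Q ∧
    (∀ p ∈ U, Disjoint (e p).vars e'.vars) ∧
    (∀ p ∈ U, ∀ q ∈ U, p ≠ q → Disjoint (e p).vars (e q).vars) ∧
    ¬ (U = {[]} ∧ (e []).Variant e') ∧
    (∀ p ∈ U, ∃ s, subtermAt e'.lhs p = some s ∧ ∀ x : V, s ≠ .var x) ∧
    IsMGU σ {d | ∃ p ∈ U, d.lhs = (e p).lhs ∧ subtermAt e'.lhs p = some d.rhs} ∧
    u = σ.app (replaceAt e'.lhs U fun p => (e p).rhs) ∧ v = σ.app e'.rhs ∧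
    X = varsAt (σ.app e'.lhs) U

/-- `⟨u, v⟩_X ∈ PCP_in(R, Q)`: the inner parallel critical pairs, all of whose overlap positions
are below the root. -/
def IsInnerPCP (R Q : Set (Equation L V)) (u v : L.Term V) (X : Set V) : Prop :=
  ∃ U : Finset Pos, (∀ p ∈ U, p ≠ []) ∧ IsParallelCriticalPair R Q U u v X

end TermRewriting

open TermRewriting

namespace TermRewriting

open FirstOrder FirstOrder.Language

variable {L : FirstOrder.Language.{u, w}} {V : Type v}

/-! ### Variables, substitutions, subterms and replacement -/

/-! Write H for a single parallel step of `P ∪ inverse P`, a symmetric relation, and T for `→_{S ∪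
P'}`. A conversion of `S ∪ P` consists of S-steps in both directions and H-steps. If it contains no
peak `←_S ∘ →_S`, `H ∘ →_S` or `←_S ∘ H`, it is a valley `→*_S ∘ H* ∘ ←*_S`, and reversibility turns
`H*` into `→*_P`, so its ends are joinable.

Peaks are eliminated by well-founded induction on a multiset of costs (`CostConv.exists_valley`). An
H-step between a and b costs `{(a, true), (b, true)}`, an S-step only `{(source, false)}`. Terms are
compared by the transitive closure of `→_S ∘ →*_{P'}`, ties by `false < true`. Whatever T reaches
from an S-reduct of a is below a, and P'-steps count as H-steps there. Hence a peak of two S-steps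
at a is replaced by a conversion below a. In a peak t H a `→_S` s, the cost `(a, true)` pays for all
that happens on the side of s, and `(t, true)` either remains, if the new H-step starts at t, or
pays for an S-step out of t and its successors. A P'-step straight from t, or a chain of H-steps
from it, could not be paid for; this explains the shape of the joinability conditions.

The peak conditions come from critical pairs (`Step.local_peak`, `ParStep.local_peak`). The hard
case is a parallel H-step strictly below the root of an S-redex. Linearity of the left-hand side
splits it into steps in the substitution and overlaps. If there are overlaps, the peak is an
instance of a parallel critical pair, taken with a substitution τ on one side and its parallel
reduct τ' on the other, and the two agree on X. The variable condition then fuses the closing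
parallel step with `τ ⇉ τ'` into one parallel step (`ParStep.subst`). -/

@[simp] theorem mem_vars_var {x y : V} : x ∈ vars (.var y : L.Term V) ↔ x = y := by
  simp [vars]

@[simp] theorem mem_vars_func {n : ℕ} {f : L.Functions n} {ts : Fin n → L.Term V} {x : V} :
    x ∈ vars (.func f ts) ↔ ∃ i, x ∈ vars (ts i) := by
  simp [vars]

theorem finite_vars (t : L.Term V) : (vars t).Finite := by
  induction t with
  | var x => simp [vars]
  | func f ts ih => simpa [vars] using Set.finite_iUnion ih

theorem Equation.finite_vars (e : Equation L V) : e.vars.Finite :=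
  (TermRewriting.finite_vars _).union (TermRewriting.finite_vars _)

theorem mem_vars_subst {t : L.Term V} {σ : V → L.Term V} {x : V} :
    x ∈ vars (t.subst σ) ↔ ∃ y ∈ vars t, x ∈ vars (σ y) := by
  induction t with
  | var y => simp [Term.subst]
  | func f ts ih =>
    simp only [Term.subst, mem_vars_func, ih]
    exact ⟨fun ⟨i, y, h, h'⟩ => ⟨y, ⟨i, h⟩, h'⟩, fun ⟨y, ⟨i, h⟩, h'⟩ => ⟨i, y, h, h'⟩⟩

theorem subst_congr {t : L.Term V} {σ τ : V → L.Term V} (h : ∀ x ∈ vars t, σ x = τ x) :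
    t.subst σ = t.subst τ := by
  induction t with
  | var y => simpa using h
  | func f ts ih =>
    simp only [Term.subst]
    exact congrArg _ (funext fun i => ih i fun x hx => h x (mem_vars_func.2 ⟨i, hx⟩))

theorem eq_of_subst_eq {t : L.Term V} {σ τ : V → L.Term V} (h : t.subst σ = t.subst τ) {x : V}
    (hx : x ∈ vars t) : σ x = τ x := by
  induction t with
  | var y => simp at hx; subst hx; simpa using h
  | func f ts ih =>
    simp only [Term.subst, Term.func.injEq, heq_eq_eq, true_and] at h
    obtain ⟨i, hi⟩ := mem_vars_func.1 hx
    exact ih i (congrFun h i) hi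

theorem subst_subst (t : L.Term V) (σ τ : V → L.Term V) :
    (t.subst σ).subst τ = t.subst fun x => (σ x).subst τ := by
  induction t with
  | var y => rfl
  | func f ts ih => simp [Term.subst, ih]

theorem subst_var (t : L.Term V) : t.subst .var = t := by
  induction t with
  | var y => rfl
  | func f ts ih => simp [Term.subst, ih]

theorem relabel_eq_subst (t : L.Term V) (g : V → V) : t.relabel g = t.subst fun x => .var (g x) := by
  induction t with
  | var y => rfl
  | func f ts ih => simp [Term.subst, Term.relabel, ih]

theorem relabel_subst (t : L.Term V) (g : V → V) (σ : V → L.Term V) :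
    (t.relabel g).subst σ = t.subst fun x => σ (g x) := by
  rw [relabel_eq_subst, subst_subst]; rfl

theorem mem_vars_relabel {t : L.Term V} {g : V → V} {x : V} :
    x ∈ vars (t.relabel g) ↔ ∃ y ∈ vars t, g y = x := by
  simp [relabel_eq_subst, mem_vars_subst, eq_comm]

@[simp] theorem subtermAt_nil (t : L.Term V) : subtermAt t [] = some t := by
  cases t <;> rfl

theorem subtermAt_func_cons {n : ℕ} (f : L.Functions n) (ts : Fin n → L.Term V) (i : Fin n)
    (p : Pos) : subtermAt (.func f ts) (i.val :: p) = subtermAt (ts i) p := by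
  simp [subtermAt]

theorem subtermAt_cons_eq_some {t s : L.Term V} {k : ℕ} {p : Pos}
    (h : subtermAt t (k :: p) = some s) :
    ∃ (n : ℕ) (f : L.Functions n) (ts : Fin n → L.Term V) (i : Fin n),
      t = .func f ts ∧ k = i.val ∧ subtermAt (ts i) p = some s := by
  cases t with
  | var x => simp [subtermAt] at h
  | @func n f ts =>
    simp only [subtermAt] at h
    split at h
    · next hk => exact ⟨n, f, ts, ⟨k, hk⟩, rfl, rfl, h⟩
    · cases h

theorem vars_subset_of_subtermAt {t s : L.Term V} {p : Pos} (h : subtermAt t p = some s) :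
    vars s ⊆ vars t := by
  induction p generalizing t with
  | nil => simp at h; subst h; rfl
  | cons k p ih =>
    obtain ⟨n, f, ts, i, rfl, rfl, h'⟩ := subtermAt_cons_eq_some h
    exact fun x hx => mem_vars_func.2 ⟨i, ih h' hx⟩

theorem exists_subtermAt_var {t : L.Term V} {x : V} (h : x ∈ vars t) :
    ∃ p, subtermAt t p = some (.var x) := by
  induction t with
  | var y => simp at h; subst h; exact ⟨[], by simp⟩
  | func f ts ih =>
    obtain ⟨i, hi⟩ := mem_vars_func.1 h
    obtain ⟨p, hp⟩ := ih i hi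
    exact ⟨i.val :: p, by rwa [subtermAt_func_cons]⟩

theorem subtermAt_subst {t s : L.Term V} {p : Pos} (h : subtermAt t p = some s)
    (σ : V → L.Term V) : subtermAt (t.subst σ) p = some (s.subst σ) := by
  induction p generalizing t with
  | nil => simp at h; subst h; simp
  | cons k p ih =>
    obtain ⟨n, f, ts, i, rfl, rfl, h'⟩ := subtermAt_cons_eq_some h
    simpa [Term.subst, subtermAt_func_cons] using ih h'

theorem replaceAll_root (t : L.Term V) {w : Pos → Option (L.Term V)} {s : L.Term V}
    (h : w [] = some s) : replaceAll t w = s := by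
  cases t <;> simp [replaceAll, h]

theorem replaceAll_func {n : ℕ} (f : L.Functions n) (ts : Fin n → L.Term V)
    {w : Pos → Option (L.Term V)} (h : w [] = none) :
    replaceAll (.func f ts) w = .func f fun i => replaceAll (ts i) fun p => w (i.val :: p) := by
  simp [replaceAll, h]

theorem replaceAll_none (t : L.Term V) : replaceAll t (fun _ => none) = t := by
  induction t with
  | var y => rfl
  | func f ts ih => rw [replaceAll_func _ _ rfl]; simp [ih]

/-- The hypothesis matters because instantiation creates new positions below the variables of `t`; a
replacement prescribed there would act only after the instantiation. -/
theorem replaceAll_subst (t : L.Term V) (w : Pos → Option (L.Term V)) (σ : V → L.Term V)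
    (h : ∀ p s, w p = some s → ∃ s', subtermAt t p = some s') :
    (replaceAll t w).subst σ = replaceAll (t.subst σ) fun p => (w p).map (·.subst σ) := by
  induction t generalizing w with
  | var y =>
    cases hw : w [] with
    | some s => rw [replaceAll_root _ hw, replaceAll_root (s := s.subst σ) _ (by simp [hw])]
    | none =>
      have : w = fun _ => none := by
        funext p
        cases p with
        | nil => exact hw
        | cons k p =>
          by_contra hn
          obtain ⟨s, hs⟩ := Option.ne_none_iff_exists'.1 hn
          obtain ⟨s', hs'⟩ := h _ _ hs
          simp [subtermAt] at hs'
      subst this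
      simp [replaceAll_none]
  | func f ts ih =>
    cases hw : w [] with
    | some s => rw [replaceAll_root _ hw, replaceAll_root (s := s.subst σ) _ (by simp [hw])]
    | none =>
      rw [replaceAll_func _ _ hw]
      simp only [Term.subst]
      rw [replaceAll_func _ _ (by simp [hw])]
      congr 1
      funext i
      refine ih i _ fun p s hs => ?_
      obtain ⟨s', hs'⟩ := h _ _ hs
      exact ⟨s', by rwa [subtermAt_func_cons] at hs'⟩

theorem replaceAt_subst (t : L.Term V) (U : Finset Pos) (r : Pos → L.Term V) (σ : V → L.Term V)
    (h : ∀ p ∈ U, ∃ s, subtermAt t p = some s) :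
    (replaceAt t U r).subst σ = replaceAt (t.subst σ) U fun p => (r p).subst σ := by
  unfold replaceAt
  rw [replaceAll_subst]
  · congr 1
    funext p
    split <;> rfl
  · intro p s hs
    split at hs
    · exact h p ‹_›
    · cases hs

theorem replaceAt_congr (t : L.Term V) {U : Finset Pos} {r r' : Pos → L.Term V}
    (h : ∀ p ∈ U, r p = r' p) : replaceAt t U r = replaceAt t U r' := by
  unfold replaceAt
  congr 1
  funext p
  split
  · rw [h p ‹_›]
  · rfl

theorem replaceAt_empty (t : L.Term V) (r : Pos → L.Term V) : replaceAt t ∅ r = t := by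
  simp [replaceAt, replaceAll_none]

theorem replaceAt_root (t : L.Term V) {U : Finset Pos} (r : Pos → L.Term V) (h : [] ∈ U) :
    replaceAt t U r = r [] :=
  replaceAll_root _ (by simp [h])

/-- The positions of `U` below the argument number `k`. -/
noncomputable def argPos (U : Finset Pos) (k : ℕ) : Finset Pos :=
  U.preimage (List.cons k) (List.cons_injective.injOn)

@[simp] theorem mem_argPos {U : Finset Pos} {k : ℕ} {p : Pos} : p ∈ argPos U k ↔ k :: p ∈ U := by
  simp [argPos]

theorem replaceAt_func {n : ℕ} (f : L.Functions n) (ts : Fin n → L.Term V) {U : Finset Pos}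
    (r : Pos → L.Term V) (h : [] ∉ U) :
    replaceAt (.func f ts) U r =
      .func f fun i => replaceAt (ts i) (argPos U i) fun p => r (i.val :: p) := by
  unfold replaceAt
  rw [replaceAll_func _ _ (by simp [h])]
  simp

theorem replaceAt_func_singleton {n : ℕ} (f : L.Functions n) (ts : Fin n → L.Term V) (i : Fin n)
    (p : Pos) (r : Pos → L.Term V) :
    replaceAt (.func f ts) {i.val :: p} r =
      .func f (Function.update ts i (replaceAt (ts i) {p} fun q => r (i.val :: q))) := by
  rw [replaceAt_func _ _ _ (by simp)]
  congr 1
  funext j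
  by_cases h : j = i
  · subst h
    simp only [Function.update_self]
    congr 1
    ext q; simp
  · rw [Function.update_of_ne h]
    have : argPos {i.val :: p} j = ∅ := by
      ext q; simp [Fin.val_inj, h]
    rw [this, replaceAt_empty]

/-- Restriction of a map from variables to terms to a finite set of variables. -/
noncomputable def Subst.restrict (θ : V → L.Term V) (A : Set V) (hA : A.Finite) : Subst L V := by
  classical
  exact ⟨fun x => if x ∈ A then θ x else .var x, hA.subset fun x hx => by
    by_contra h; simp [h] at hx⟩

theorem Subst.restrict_app (θ : V → L.Term V) {A : Set V} (hA : A.Finite) {t : L.Term V}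
    (h : vars t ⊆ A) : (Subst.restrict θ A hA).app t = t.subst θ :=
  subst_congr fun x hx => by simp [Subst.restrict, h hx]

/-! ### Rewrite steps by structural rules -/

/-- One rewrite step, with arbitrary maps from variables to terms. -/
inductive Step (R : Set (Equation L V)) : L.Term V → L.Term V → Prop
  | root {e : Equation L V} (he : e ∈ R) (θ : V → L.Term V) :
      Step R (e.lhs.subst θ) (e.rhs.subst θ)
  | arg {n : ℕ} (f : L.Functions n) (ts : Fin n → L.Term V) (i : Fin n) {v : L.Term V}
      (h : Step R (ts i) v) : Step R (.func f ts) (.func f (Function.update ts i v))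

/-- A parallel rewrite step such that all variables of the contracted subterms of the target
belong to `X`. -/
inductive ParStep (R : Set (Equation L V)) (X : Set V) : L.Term V → L.Term V → Prop
  | root {e : Equation L V} (he : e ∈ R) (θ : V → L.Term V) (hX : vars (e.rhs.subst θ) ⊆ X) :
      ParStep R X (e.lhs.subst θ) (e.rhs.subst θ)
  | var (x : V) : ParStep R X (.var x) (.var x)
  | func {n : ℕ} (f : L.Functions n) {ts ts' : Fin n → L.Term V}
      (h : ∀ i, ParStep R X (ts i) (ts' i)) : ParStep R X (.func f ts) (.func f ts')

/-- Only the values at the finitely many variables of the equation matter, so an arbitrary map can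
be cut down to a substitution with finite domain. -/
theorem step_iff_rew {R : Set (Equation L V)} {s t : L.Term V} : Step R s t ↔ Rew R s t := by
  constructor
  · intro h
    induction h with
    | @root e he θ =>
      refine ⟨e, he, Subst.restrict θ e.vars e.finite_vars, [], ?_, ?_⟩
      · rw [Subst.restrict_app (A := e.vars) (t := e.lhs) _ _ Set.subset_union_left, subtermAt_nil]
      · rw [Subst.restrict_app (A := e.vars) (t := e.rhs) _ _ Set.subset_union_right, replaceAt_root _ _ (by simp)]
    | arg f ts i _ ih =>
      obtain ⟨e, he, θ, p, hp, rfl⟩ := ih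
      exact ⟨e, he, θ, i.val :: p, by rwa [subtermAt_func_cons],
        by rw [replaceAt_func_singleton]⟩
  · rintro ⟨e, he, θ, p, hp, rfl⟩
    induction p generalizing s with
    | nil =>
      simp only [subtermAt_nil, Option.some.injEq] at hp
      subst hp
      rw [replaceAt_root _ _ (by simp)]
      exact .root he _
    | cons k p ih =>
      obtain ⟨n, f, ts, i, rfl, rfl, h⟩ := subtermAt_cons_eq_some hp
      rw [replaceAt_func_singleton]
      exact .arg f ts i (ih h)

theorem step_eq_rew (R : Set (Equation L V)) : Step R = Rew R :=
  funext₂ fun _ _ => propext step_iff_rew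

/-- The structural form forgets the positions. All that survives of `U` is a bound on the variables
of the contracted parts of the target, which is what the variable condition on parallel critical
pairs is about. -/
theorem ParRewAt.parStep {R : Set (Equation L V)} {X : Set V} {U : Finset Pos} {s t : L.Term V}
    (h : ParRewAt R U s t) (hX : varsAt t U ⊆ X) : ParStep R X s t := by
  obtain ⟨-, e, θ, h, rfl⟩ := h
  induction s generalizing U e θ with
  | var x =>
    by_cases hU : [] ∈ U
    · obtain ⟨he, hs⟩ := h _ hU
      rw [replaceAt_root _ _ hU] at hX ⊢
      rw [subtermAt_nil, Option.some.injEq] at hs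
      rw [hs]
      exact .root he _ fun y hy => hX ⟨[], hU, _, subtermAt_nil _, hy⟩
    · have : U = ∅ := by
        rw [Finset.eq_empty_iff_forall_notMem]
        rintro (_ | ⟨k, p⟩) hp
        · exact hU hp
        · simpa [subtermAt] using (h _ hp).2
      subst this
      rw [replaceAt_empty]
      exact .var x
  | func f ts ih =>
    by_cases hU : [] ∈ U
    · obtain ⟨he, hs⟩ := h _ hU
      rw [replaceAt_root _ _ hU] at hX ⊢
      rw [subtermAt_nil, Option.some.injEq] at hs
      rw [hs]
      exact .root he _ fun y hy => hX ⟨[], hU, _, subtermAt_nil _, hy⟩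
    · rw [replaceAt_func _ _ _ hU] at hX ⊢
      refine .func f fun i => ih i (fun p => e (i.val :: p)) (fun p => θ (i.val :: p)) ?_ ?_
      · intro p hp
        simpa [subtermAt_func_cons] using h _ (mem_argPos.1 hp)
      · rintro y ⟨p, hp, s, hs, hy⟩
        exact hX ⟨i.val :: p, mem_argPos.1 hp, s, by rwa [subtermAt_func_cons], hy⟩

theorem ParRew.parStep {R : Set (Equation L V)} {s t : L.Term V} (h : ParRew R s t) :
    ParStep R Set.univ s t :=
  h.choose_spec.parStep (Set.subset_univ _)

theorem ParStep.refl (R : Set (Equation L V)) (X : Set V) (t : L.Term V) : ParStep R X t t := by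
  induction t with
  | var x => exact .var x
  | func f ts ih => exact .func f ih

theorem Step.parStep {R : Set (Equation L V)} {s t : L.Term V} (h : Step R s t) :
    ParStep R Set.univ s t := by
  induction h with
  | root he θ => exact .root he θ (Set.subset_univ _)
  | arg f ts i _ ih =>
    refine .func f fun j => ?_
    by_cases hj : j = i
    · subst hj; simpa using ih
    · simpa [Function.update_of_ne hj] using ParStep.refl _ _ _

theorem Step.mono {R R' : Set (Equation L V)} {s t : L.Term V} (hR : R ⊆ R') (h : Step R s t) :
    Step R' s t := by
  induction h with
  | root he θ => exact .root (hR he) θ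
  | arg f ts i _ ih => exact .arg f ts i ih

theorem Step.subst {R : Set (Equation L V)} {s t : L.Term V} (h : Step R s t) (σ : V → L.Term V) :
    Step R (s.subst σ) (t.subst σ) := by
  induction h with
  | root he θ => simpa only [subst_subst] using Step.root he _
  | @arg n f ts i v _ ih =>
    have := Step.arg f (fun j => (ts j).subst σ) i ih
    simp only [Term.subst]
    convert this using 2
    funext j
    by_cases hj : j = i
    · subst hj; simp
    · simp [Function.update_of_ne hj]

theorem Step.of_subsetVariant {R R' : Set (Equation L V)} {s t : L.Term V}
    (hR : SubsetVariant R R') (h : Step R s t) : Step R' s t := by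
  induction h with
  | @root e he θ =>
    obtain ⟨e₀, he₀, π, hl, hr⟩ := hR e he
    rw [hl, hr, relabel_subst, relabel_subst]
    exact .root he₀ _
  | arg f ts i _ ih => exact .arg f ts i ih

/-- The bound is `Set.univ` because a bound on the reducts says nothing about the redexes, which
become the reducts after reversal. -/
theorem ParStep.symm {R : Set (Equation L V)} (hR : ∀ e ∈ R, e.swap ∈ R) {s t : L.Term V}
    (h : ParStep R Set.univ s t) : ParStep R Set.univ t s := by
  induction h with
  | root he θ => exact .root (hR _ he) θ (Set.subset_univ _)
  | var x => exact .var x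
  | func f _ ih => exact .func f ih

/-- Parallel steps on a term and on a substitution combine if the contracted part is untouched
by the step on the substitution. -/
theorem ParStep.subst {R : Set (Equation L V)} {X : Set V} {s t : L.Term V} (h : ParStep R X s t)
    {σ τ : V → L.Term V} (hστ : ∀ x, ParStep R Set.univ (σ x) (τ x)) (hX : ∀ x ∈ X, τ x = σ x) :
    ParStep R Set.univ (s.subst σ) (t.subst τ) := by
  induction h with
  | @root e he θ hr =>
    -- On a reduct `τ` and `σ` agree, so the step is simply an instance by `σ`.
    rw [subst_congr fun x hx => hX x (hr hx), subst_subst, subst_subst]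
    exact .root he _ (Set.subset_univ _)
  | var x => exact hστ x
  | func f _ ih => exact .func f ih

/-! ### Reflexive transitive closure -/

/-- Congruence of reachability, all arguments at once. -/
theorem reflTransGen_func {R : Set (Equation L V)} {n : ℕ} (f : L.Functions n)
    {ts ts' : Fin n → L.Term V} (h : ∀ i, Relation.ReflTransGen (Step R) (ts i) (ts' i)) :
    Relation.ReflTransGen (Step R) (.func f ts) (.func f ts') := by
  classical
  have one : ∀ (us : Fin n → L.Term V) i v, Relation.ReflTransGen (Step R) (us i) v →
      Relation.ReflTransGen (Step R) (.func f us) (.func f (Function.update us i v)) := by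
    intro us i v hv
    induction hv with
    | refl => simp [Relation.ReflTransGen.refl]
    | @tail b c _ hbc ih =>
      refine ih.tail ?_
      have := Step.arg (R := R) f (Function.update us i b) i (v := c) (by simpa using hbc)
      simpa using this
  -- The arguments are rewritten one after the other; `A` collects those already done.
  have key : ∀ A : Finset (Fin n), Relation.ReflTransGen (Step R) (.func f ts)
      (.func f fun i => if i ∈ A then ts' i else ts i) := by
    intro A
    induction A using Finset.induction_on with
    | empty => simp [Relation.ReflTransGen.refl]
    | @insert a A ha ih =>
      refine ih.trans ?_
      convert one _ a (ts' a) _ using 2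
      · funext i
        by_cases hi : i = a
        · subst hi; simp
        · simp [hi]
      · simpa [ha] using h a
  simpa using key Finset.univ

theorem reflTransGen_subst_right {R : Set (Equation L V)} (t : L.Term V) {σ τ : V → L.Term V}
    (h : ∀ x, Relation.ReflTransGen (Step R) (σ x) (τ x)) :
    Relation.ReflTransGen (Step R) (t.subst σ) (t.subst τ) := by
  induction t with
  | var x => exact h x
  | func f ts ih => exact reflTransGen_func f ih

theorem reflTransGen_subst {R : Set (Equation L V)} {s t : L.Term V}
    (h : Relation.ReflTransGen (Step R) s t) (σ : V → L.Term V) :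
    Relation.ReflTransGen (Step R) (s.subst σ) (t.subst σ) := by
  induction h with
  | refl => exact .refl
  | tail _ h ih => exact ih.tail (h.subst σ)

theorem reflTransGen_arg {R : Set (Equation L V)} {n : ℕ} (f : L.Functions n)
    (ts : Fin n → L.Term V) (i : Fin n) {v v' : L.Term V}
    (h : Relation.ReflTransGen (Step R) v v') :
    Relation.ReflTransGen (Step R) (.func f (Function.update ts i v))
      (.func f (Function.update ts i v')) := by
  refine reflTransGen_func f fun j => ?_
  by_cases hj : j = i
  · subst hj; simpa using h
  · simp [Function.update_of_ne hj, Relation.ReflTransGen.refl]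

/-! ### Unification -/

/-- The number of symbols of a term. -/
def termSize : L.Term V → ℕ
  | .var _ => 1
  | .func _ ts => 1 + ∑ i, termSize (ts i)

theorem termSize_pos (t : L.Term V) : 0 < termSize t := by
  cases t <;> simp [termSize]

theorem termSize_subst_le {t : L.Term V} {τ : V → L.Term V} {x : V} (hx : x ∈ vars t) :
    termSize (τ x) ≤ termSize (t.subst τ) := by
  induction t with
  | var y => simp at hx; subst hx; rfl
  | func f ts ih =>
    obtain ⟨i, hi⟩ := mem_vars_func.1 hx
    refine (ih i hi).trans ?_
    simp only [Term.subst, termSize]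
    have := Finset.single_le_sum (f := fun i => termSize ((ts i).subst τ))
      (fun _ _ => Nat.zero_le _) (Finset.mem_univ i)
    omega

/-- The occurs check: if `x` occurred properly inside `t`, then `t.subst τ` would have more symbols
than `τ x`. -/
theorem eq_var_of_subst_eq {t : L.Term V} {τ : V → L.Term V} {x : V} (h : τ x = t.subst τ)
    (hx : x ∈ vars t) : t = .var x := by
  cases t with
  | var y => simp at hx; rw [hx]
  | func f ts =>
    exfalso
    obtain ⟨i, hi⟩ := mem_vars_func.1 hx
    have h₁ := termSize_subst_le (τ := τ) hi
    rw [h] at h₁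
    simp only [Term.subst, termSize] at h₁
    have := Finset.single_le_sum (f := fun i => termSize ((ts i).subst τ))
      (fun _ _ => Nat.zero_le _) (Finset.mem_univ i)
    omega

/-- `τ` unifies all equations of `E`. -/
def Unifies (τ : V → L.Term V) (E : Set (Equation L V)) : Prop :=
  ∀ e ∈ E, e.lhs.subst τ = e.rhs.subst τ

/-- The variables of a set of equations. -/
def eqsVars (E : Set (Equation L V)) : Set V :=
  {x | ∃ e ∈ E, x ∈ e.vars}

/-- An idempotent most general unifier of `E` that involves only variables of `E`. -/
structure StrongMGU (E : Set (Equation L V)) (σ : V → L.Term V) : Prop where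
  unifies : Unifies σ E
  factor : ∀ τ, Unifies τ E → ∀ x, (σ x).subst τ = τ x
  dom : ∀ x, x ∉ eqsVars E → σ x = .var x
  range : ∀ x ∈ eqsVars E, vars (σ x) ⊆ eqsVars E

theorem StrongMGU.of_iff {E E' : Set (Equation L V)} {σ : V → L.Term V} (h : StrongMGU E' σ)
    (hE : ∀ τ, Unifies τ E ↔ Unifies τ E') (hv : eqsVars E' ⊆ eqsVars E) : StrongMGU E σ where
  unifies := (hE σ).2 h.unifies
  factor τ hτ := h.factor τ ((hE τ).1 hτ)
  dom x hx := h.dom x fun h' => hx (hv h')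
  range x hx := by
    by_cases hx' : x ∈ eqsVars E'
    · exact (h.range x hx').trans hv
    · intro y hy
      rw [h.dom x hx', mem_vars_var] at hy
      exact hy ▸ hx

theorem unifies_list_cons {τ : V → L.Term V} {e : Equation L V} {l : List (Equation L V)} :
    Unifies τ {d | d ∈ e :: l} ↔ e.lhs.subst τ = e.rhs.subst τ ∧ Unifies τ {d | d ∈ l} := by
  simp [Unifies]

theorem mem_eqsVars_list_cons {x : V} {e : Equation L V} {l : List (Equation L V)} :
    x ∈ eqsVars {d | d ∈ e :: l} ↔ x ∈ e.vars ∨ x ∈ eqsVars {d | d ∈ l} := by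
  simp [eqsVars]

/-- Apply a substitution to both sides of an equation. -/
def Equation.map (e : Equation L V) (ρ : V → L.Term V) : Equation L V :=
  ⟨e.lhs.subst ρ, e.rhs.subst ρ⟩

/-- Elimination of a variable. -/
theorem StrongMGU.eliminate {x : V} {t : L.Term V} {l : List (Equation L V)} {σ : V → L.Term V}
    [DecidableEq V] (hx : x ∉ vars t)
    (h : StrongMGU {d | d ∈ l.map (·.map (Function.update Term.var x t))} σ) :
    StrongMGU {d | d ∈ (⟨.var x, t⟩ : Equation L V) :: l}
      fun y => ((Function.update Term.var x t : V → L.Term V) y).subst σ := by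
  set ρ : V → L.Term V := Function.update Term.var x t with hρ
  have hρx : ρ x = t := by simp [hρ]
  have hρy : ∀ y, y ≠ x → ρ y = .var y := fun y hy => by simp [hρ, Function.update_of_ne hy]
  have hρt : t.subst ρ = t := by
    conv_rhs => rw [← subst_var t]
    exact subst_congr fun y hy => hρy y fun h => hx (h ▸ hy)
  have hvars : ∀ y ∈ eqsVars {d | d ∈ l.map (·.map ρ)},
      y ∈ eqsVars {d | d ∈ (⟨.var x, t⟩ : Equation L V) :: l} := by
    rintro y ⟨e', he', hy⟩
    obtain ⟨e, he, rfl⟩ := List.mem_map.1 he'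
    have : ∃ z ∈ e.vars, y ∈ vars (ρ z) := by
      rcases hy with hy | hy <;> obtain ⟨z, hz, hyz⟩ := mem_vars_subst.1 hy
      · exact ⟨z, Or.inl hz, hyz⟩
      · exact ⟨z, Or.inr hz, hyz⟩
    obtain ⟨z, hz, hyz⟩ := this
    rw [mem_eqsVars_list_cons]
    by_cases hzx : z = x
    · rw [hzx, hρx] at hyz
      exact Or.inl (Or.inr hyz)
    · rw [hρy z hzx, mem_vars_var] at hyz
      exact Or.inr ⟨e, he, hyz ▸ hz⟩
  have hfac : ∀ τ : V → L.Term V, τ x = t.subst τ → ∀ y, (ρ y).subst τ = τ y := by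
    intro τ hτ y
    by_cases hy : y = x
    · rw [hy, hρx, hτ]
    · rw [hρy y hy]; rfl
  constructor
  · rw [unifies_list_cons]
    constructor
    · change (ρ x).subst σ = _
      rw [← subst_subst, hρt, hρx]
    · intro e he
      rw [← subst_subst, ← subst_subst]
      exact h.unifies _ (List.mem_map.2 ⟨e, he, rfl⟩)
  · intro τ hτ y
    rw [unifies_list_cons] at hτ
    rw [subst_subst, subst_congr (τ := τ), hfac τ hτ.1]
    intro z _
    refine h.factor τ ?_ z
    intro e' he'
    obtain ⟨e, he, rfl⟩ := List.mem_map.1 he'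
    simp only [Equation.map, subst_subst, hfac τ hτ.1]
    exact hτ.2 e he
  · intro y hy
    have hyx : y ≠ x := by
      rintro rfl
      exact hy (mem_eqsVars_list_cons.2 (Or.inl (Or.inl (by simp))))
    simp only [hρy y hyx]
    exact h.dom y fun hy' => hy (hvars y hy')
  · intro y hy z hz
    obtain ⟨a, ha, hza⟩ := mem_vars_subst.1 hz
    have ha' : a ∈ eqsVars {d | d ∈ (⟨.var x, t⟩ : Equation L V) :: l} := by
      by_cases hyx : y = x
      · rw [hyx, hρx] at ha
        exact mem_eqsVars_list_cons.2 (Or.inl (Or.inr ha))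
      · rw [hρy y hyx, mem_vars_var] at ha
        exact ha ▸ hy
    by_cases haE : a ∈ eqsVars {d | d ∈ l.map (·.map ρ)}
    · exact hvars z (h.range a haE hza)
    · rw [h.dom a haE, mem_vars_var] at hza
      exact hza ▸ ha'

/-- The recursion is measured by the total size of the left-hand sides instantiated by the given
unifier `τ`. Eliminating a variable leaves the instances of the other equations unchanged, since `τ`
absorbs the elimination, and discards one equation of positive size; decomposition loses a function
symbol. No separate count of variables is needed. -/
theorem exists_strongMGU_list (τ : V → L.Term V) (l : List (Equation L V))
    (hl : Unifies τ {d | d ∈ l}) : ∃ σ, StrongMGU {d | d ∈ l} σ := by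
  classical
  induction hn : (l.map fun e => termSize (e.lhs.subst τ)).sum using Nat.strong_induction_on
    generalizing l with
  | _ n ih =>
  subst hn
  match l with
  | [] =>
    exact ⟨.var, by simp [Unifies], fun _ _ _ => rfl, fun _ _ => rfl, by simp [eqsVars]⟩
  | ⟨a, b⟩ :: l =>
    have hl' := unifies_list_cons.1 hl
    have elim : ∀ (x : V) (t : L.Term V), τ x = t.subst τ →
        ((⟨a, b⟩ : Equation L V) = ⟨.var x, t⟩ ∨ (⟨a, b⟩ : Equation L V) = ⟨t, .var x⟩) →
        ∃ σ, StrongMGU {d | d ∈ (⟨a, b⟩ : Equation L V) :: l} σ := by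
      intro x t hxt hab
      have hfac : ∀ y,
          ((Function.update Term.var x t : V → L.Term V) y).subst τ = τ y := by
        intro y
        by_cases hy : y = x
        · subst hy; simp [hxt]
        · simp [Function.update_of_ne hy]
      have hlt : ((l.map (·.map (Function.update Term.var x t))).map
          fun e => termSize (e.lhs.subst τ)).sum <
          (((⟨a, b⟩ : Equation L V) :: l).map fun e => termSize (e.lhs.subst τ)).sum := by
        simp only [List.map_map, List.map_cons, List.sum_cons, Function.comp_def, Equation.map,
          subst_subst, hfac]
        exact Nat.lt_add_of_pos_left (termSize_pos _)
      have hU : Unifies τ {d | d ∈ l.map (·.map (Function.update Term.var x t))} := by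
        intro e' he'
        obtain ⟨e, he, rfl⟩ := List.mem_map.1 he'
        simp only [Equation.map, subst_subst, hfac]
        exact hl'.2 e he
      by_cases hx : x ∈ vars t
      -- The equation is the trivial `x ≈ x` and can be dropped.
      · have ht := eq_var_of_subst_eq hxt hx
        subst ht
        have hab' : a = .var x ∧ b = .var x := by
          rcases hab with h | h <;> simpa [Equation.mk.injEq] using h
        obtain ⟨rfl, rfl⟩ := hab'
        obtain ⟨σ, hσ⟩ := ih _ (by simpa using termSize_pos _) l hl'.2 rfl
        refine ⟨σ, hσ.of_iff (fun τ' => ?_) fun y hy => mem_eqsVars_list_cons.2 (Or.inr hy)⟩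
        rw [unifies_list_cons]; simp
      · obtain ⟨σ, hσ⟩ := ih _ hlt _ hU rfl
        refine ⟨_, (hσ.eliminate hx).of_iff (fun τ' => ?_) fun y hy => ?_⟩
        · rw [unifies_list_cons, unifies_list_cons]
          rcases hab with h | h <;> rw [Equation.mk.injEq] at h <;> obtain ⟨rfl, rfl⟩ := h
          · rfl
          · rw [eq_comm]
        · rw [mem_eqsVars_list_cons] at hy ⊢
          refine hy.imp_left fun hy => ?_
          rcases hab with h | h <;> rw [Equation.mk.injEq] at h <;> obtain ⟨rfl, rfl⟩ := h
          · exact hy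
          · exact Or.symm hy
    cases a with
    | var x => exact elim x b hl'.1 (Or.inl rfl)
    | @func n f ts =>
      cases b with
      | var x => exact elim x _ hl'.1.symm (Or.inr rfl)
      | @func m g us =>
        have h₁ := hl'.1
        simp only [Term.subst, Term.func.injEq] at h₁
        obtain ⟨rfl, h₁⟩ := h₁
        simp only [heq_eq_eq] at h₁
        obtain ⟨rfl, h₁⟩ := h₁
        have hdec : ∀ τ' : V → L.Term V,
            Unifies τ' {d | d ∈ (⟨.func f ts, .func f us⟩ : Equation L V) :: l} ↔
            Unifies τ' {d | d ∈ List.ofFn (fun i => (⟨ts i, us i⟩ : Equation L V)) ++ l} := by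
          intro τ'
          rw [unifies_list_cons]
          simp only [Unifies, Set.mem_ofPred_eq, List.mem_append, List.mem_ofFn, or_imp,
            forall_and, forall_exists_index, Term.subst, Term.func.injEq, heq_eq_eq, true_and,
            funext_iff]
          refine and_congr_left fun _ => ⟨?_, ?_⟩
          · rintro h e i rfl; exact h i
          · intro h i; exact h _ i rfl
        obtain ⟨σ, hσ⟩ := ih _ (by
          simp only [List.map_append, List.sum_append, List.map_ofFn, List.sum_ofFn,
            List.map_cons, List.sum_cons, Term.subst, termSize, Function.comp_def]
          omega) _ ((hdec τ).1 hl) rfl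
        refine ⟨σ, hσ.of_iff hdec ?_⟩
        rintro y ⟨e, he, hy⟩
        rw [mem_eqsVars_list_cons]
        rcases List.mem_append.1 he with he | he
        · obtain ⟨i, rfl⟩ := List.mem_ofFn.1 he
          exact Or.inl (hy.imp (fun h => mem_vars_func.2 ⟨i, h⟩) fun h => mem_vars_func.2 ⟨i, h⟩)
        · exact Or.inr ⟨e, he, hy⟩

theorem finite_eqsVars {E : Set (Equation L V)} (hE : E.Finite) : (eqsVars E).Finite := by
  have : eqsVars E = ⋃ e ∈ E, e.vars := by ext x; simp [eqsVars]
  rw [this]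
  exact hE.biUnion fun e _ => e.finite_vars

/-- A finite unifiable set of equations has a most general unifier. -/
theorem exists_strongMGU {E : Set (Equation L V)} (hE : E.Finite) {τ : V → L.Term V}
    (h : Unifies τ E) : ∃ σ : Subst L V, StrongMGU E σ.toFun := by
  have hl : {d | d ∈ hE.toFinset.toList} = E := by ext; simp
  obtain ⟨σ, hσ⟩ := exists_strongMGU_list τ hE.toFinset.toList (by rwa [hl])
  rw [hl] at hσ
  exact ⟨⟨σ, (finite_eqsVars hE).subset fun x hx => by
    by_contra h'; exact hx (hσ.dom x h')⟩, hσ⟩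

theorem StrongMGU.isMGU {E : Set (Equation L V)} {σ : Subst L V} (h : StrongMGU E σ.toFun) :
    IsMGU σ E :=
  ⟨h.unifies, fun τ hτ => ⟨τ, fun x => (h.factor τ.toFun hτ x).symm⟩⟩

/-! ### Renaming apart -/

/-- `F` is mapped bijectively onto an equally large set of fresh variables, and a bijection between
finite sets extends to a permutation, the form of renaming that variants require. -/
theorem exists_perm_disjoint [Infinite V] {F A : Set V} (hF : F.Finite) (hA : A.Finite) :
    ∃ π : Equiv.Perm V, Disjoint (π '' F) A := by
  classical
  obtain ⟨G, hGA, hG⟩ : ∃ G : Finset V, (G : Set V) ⊆ (F ∪ A)ᶜ ∧ G.card = hF.toFinset.card :=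
    Set.Infinite.exists_subset_card_eq (hF.union hA).infinite_compl _
  obtain ⟨g⟩ : Nonempty (hF.toFinset ≃ G) := ⟨Finset.equivOfCardEq hG.symm⟩
  refine ⟨g.extendSubtype (p := (· ∈ hF.toFinset)) (q := (· ∈ G)), ?_⟩
  rw [Set.disjoint_left]
  rintro _ ⟨x, hx, rfl⟩ hxA
  have := g.extendSubtype_mem x (hF.mem_toFinset.2 hx)
  exact hGA this (Or.inr hxA)

theorem exists_perms_disjoint [Infinite V] {ι : Type*} (U : Finset ι) (F : ι → Set V)
    (hF : ∀ p, (F p).Finite) {A : Set V} (hA : A.Finite) :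
    ∃ π : ι → Equiv.Perm V, (∀ p ∈ U, Disjoint (π p '' F p) A) ∧
      ∀ p ∈ U, ∀ q ∈ U, p ≠ q → Disjoint (π p '' F p) (π q '' F q) := by
  classical
  induction U using Finset.induction_on with
  | empty => exact ⟨fun _ => 1, by simp, by simp⟩
  | @insert a U ha ih =>
    obtain ⟨π, h₁, h₂⟩ := ih
    obtain ⟨ρ, hρ⟩ := exists_perm_disjoint (hF a)
      (hA.union (U.finite_toSet.biUnion fun q _ => (hF q).image (π q)))
    rw [Set.disjoint_union_right, Set.disjoint_iUnion₂_right] at hρ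
    have hne : ∀ p ∈ U, p ≠ a := fun p hp h => ha (h ▸ hp)
    refine ⟨Function.update π a ρ, ?_, ?_⟩
    · intro p hp
      rcases Finset.mem_insert.1 hp with rfl | hp
      · simpa using hρ.1
      · simpa [Function.update_of_ne (hne p hp)] using h₁ p hp
    · intro p hp q hq hpq
      rcases Finset.mem_insert.1 hp with rfl | hp' <;>
        rcases Finset.mem_insert.1 hq with rfl | hq'
      · exact absurd rfl hpq
      · simpa [Function.update_of_ne (hne q hq')] using hρ.2 q hq'
      · simpa [Function.update_of_ne (hne p hp')] using (hρ.2 p hp').symm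
      · simpa [Function.update_of_ne (hne p hp'), Function.update_of_ne (hne q hq')]
          using h₂ p hp' q hq' hpq

/-- Renaming of the variables of an equation. -/
def Equation.rename (e : Equation L V) (π : Equiv.Perm V) : Equation L V :=
  ⟨e.lhs.relabel π, e.rhs.relabel π⟩

theorem Equation.variant_rename (e : Equation L V) (π : Equiv.Perm V) :
    e.Variant (e.rename π) := ⟨π, rfl, rfl⟩

theorem Equation.vars_rename (e : Equation L V) (π : Equiv.Perm V) :
    (e.rename π).vars = π '' e.vars := by
  ext x
  simp only [Equation.vars, Equation.rename, Set.mem_union, mem_vars_relabel, Set.mem_image]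
  constructor
  · rintro (⟨y, h, h'⟩ | ⟨y, h, h'⟩)
    exacts [⟨y, Or.inl h, h'⟩, ⟨y, Or.inr h, h'⟩]
  · rintro ⟨y, h | h, h'⟩
    exacts [Or.inl ⟨y, h, h'⟩, Or.inr ⟨y, h, h'⟩]

theorem MemVariant.of_mem {e : Equation L V} {R : Set (Equation L V)} (h : e ∈ R) :
    MemVariant e R :=
  ⟨e, h, 1, by simp [relabel_eq_subst, subst_var], by simp [relabel_eq_subst, subst_var]⟩

/-! ### Steps from an instance of a term -/

/-- A step from an instance of `l` takes place in the substitution or overlaps with `l`. -/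
theorem Step.decompose {R : Set (Equation L V)} {l s : L.Term V} {θ : V → L.Term V}
    (h : Step R (l.subst θ) s) :
    (∃ θ', (∀ x, Relation.ReflTransGen (Step R) (θ x) (θ' x)) ∧
      Relation.ReflTransGen (Step R) s (l.subst θ')) ∨
    ∃ (p : Pos) (s' : L.Term V) (e : Equation L V) (θ₁ : V → L.Term V), e ∈ R ∧
      subtermAt l p = some s' ∧ (∀ x, s' ≠ .var x) ∧ s'.subst θ = e.lhs.subst θ₁ ∧
      s = replaceAt (l.subst θ) {p} fun _ => e.rhs.subst θ₁ := by
  classical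
  induction l generalizing s with
  | var x =>
    refine Or.inl ⟨Function.update θ x s, fun y => ?_, ?_⟩
    · by_cases hy : y = x
      · subst hy; simpa using Relation.ReflTransGen.single h
      · simp [Function.update_of_ne hy, Relation.ReflTransGen.refl]
    · simp [Term.subst, Relation.ReflTransGen.refl]
  | @func n f ts ih =>
    generalize ht : (Term.func f ts).subst θ = t at h
    cases h with
    | @root e he θ₁ =>
      exact Or.inr ⟨[], _, e, θ₁, he, subtermAt_nil _, by simp, ht,
        by rw [replaceAt_root _ _ (by simp)]⟩
    | @arg m g us i v hv =>
      simp only [Term.subst, Term.func.injEq] at ht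
      obtain ⟨rfl, ht⟩ := ht
      simp only [heq_eq_eq] at ht
      obtain ⟨rfl, rfl⟩ := ht
      rcases ih i hv with ⟨θ', hθ', hv'⟩ | ⟨p, s', e, θ₁, he, hp, hs', heq, rfl⟩
      -- The rewritten variable may occur in other arguments as well. The step is repeated there,
      -- whence reachability instead of equality.
      · refine Or.inl ⟨θ', hθ', reflTransGen_func f fun j => ?_⟩
        by_cases hj : j = i
        · subst hj; simpa using hv'
        · simpa [Function.update_of_ne hj] using reflTransGen_subst_right (ts j) hθ'
      · refine Or.inr ⟨i.val :: p, s', e, θ₁, he, by rwa [subtermAt_func_cons], hs', heq, ?_⟩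
        exact (replaceAt_func_singleton f (fun j => (ts j).subst θ) i p
          fun _ => e.rhs.subst θ₁).symm

theorem LinearTerm.arg {n : ℕ} {f : L.Functions n} {ts : Fin n → L.Term V}
    (h : LinearTerm (.func f ts)) (i : Fin n) : LinearTerm (ts i) := by
  intro x p q hp hq
  have := h x (i.val :: p) (i.val :: q) (by rwa [subtermAt_func_cons])
    (by rwa [subtermAt_func_cons])
  simpa using this

theorem LinearTerm.arg_unique {n : ℕ} {f : L.Functions n} {ts : Fin n → L.Term V}
    (h : LinearTerm (.func f ts)) {x : V} {i j : Fin n} (hi : x ∈ vars (ts i))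
    (hj : x ∈ vars (ts j)) : i = j := by
  obtain ⟨p, hp⟩ := exists_subtermAt_var hi
  obtain ⟨q, hq⟩ := exists_subtermAt_var hj
  have := h x (i.val :: p) (j.val :: q) (by rwa [subtermAt_func_cons])
    (by rwa [subtermAt_func_cons])
  simp only [List.cons.injEq, Fin.val_inj] at this
  exact this.1

/-- `t` arises from `l.subst θ` by contracting redexes at the non-variable positions `U` of `l`
and by parallel steps in the part of the substitution `θ` that is not below `U`. -/
def OverlapStep (R : Set (Equation L V)) (l : L.Term V) (θ : V → L.Term V) (t : L.Term V)
    (U : Finset Pos) : Prop :=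
  ∃ (e : Pos → Equation L V) (ρ : Pos → V → L.Term V) (θ' : V → L.Term V),
    ParallelPos U ∧
    (∀ p ∈ U, e p ∈ R ∧ ∃ s, subtermAt l p = some s ∧ (∀ x, s ≠ .var x) ∧
      s.subst θ = (e p).lhs.subst (ρ p)) ∧
    (∀ x, ParStep R Set.univ (θ x) (θ' x)) ∧
    (∀ x ∈ varsAt l U, θ' x = θ x) ∧
    t = replaceAt (l.subst θ') U fun p => (e p).rhs.subst (ρ p)

/-- By linearity each variable belongs to a single argument, so the substitutions obtained for the
arguments glue together. The clause on the root position is what later makes the critical pair an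
inner one. -/
theorem OverlapStep.func {R : Set (Equation L V)} {n : ℕ} {f : L.Functions n}
    {ls ts : Fin n → L.Term V} {θ : V → L.Term V} (hlin : LinearTerm (.func f ls))
    (h : ∀ i, ∃ U, OverlapStep R (ls i) θ (ts i) U) :
    ∃ U, [] ∉ U ∧ OverlapStep R (.func f ls) θ (.func f ts) U := by
  classical
  choose U e ρ θ' hpar he hθ' hX ht using h
  let W : Finset Pos := Finset.univ.biUnion fun i => (U i).image (List.cons i.val)
  have hW : ∀ p, p ∈ W ↔ ∃ i, ∃ q ∈ U i, i.val :: q = p := fun p => by simp [W]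
  have hWc : ∀ (i : Fin n) q, i.val :: q ∈ W ↔ q ∈ U i := by
    intro i q
    rw [hW]
    constructor
    · rintro ⟨j, q', hq', h⟩
      simp only [List.cons.injEq, Fin.val_inj] at h
      obtain ⟨rfl, rfl⟩ := h
      exact hq'
    · exact fun h => ⟨i, q, h, rfl⟩
  have hW0 : [] ∉ W := by rw [hW]; simp
  have harg : ∀ i : Fin n, argPos W i = U i := fun i => by ext q; simp [hWc]
  -- The values at the root and beyond the arity are dummies, as every position in `W` starts with
  -- an argument number.
  let e' : Pos → Equation L V
    | [] => ⟨.func f ls, .func f ls⟩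
    | k :: q => if hk : k < n then e ⟨k, hk⟩ q else ⟨.func f ls, .func f ls⟩
  let ρ' : Pos → V → L.Term V
    | [] => θ
    | k :: q => if hk : k < n then ρ ⟨k, hk⟩ q else θ
  have he' : ∀ (i : Fin n) q, e' (i.val :: q) = e i q := fun i q => by simp [e']
  have hρ' : ∀ (i : Fin n) q, ρ' (i.val :: q) = ρ i q := fun i q => by simp [ρ']
  let θ'' : V → L.Term V := fun x => if hx : ∃ i, x ∈ vars (ls i) then θ' hx.choose x else θ x
  have hθ'' : ∀ i, ∀ x ∈ vars (ls i), θ'' x = θ' i x := by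
    intro i x hx
    have hx' : ∃ i, x ∈ vars (ls i) := ⟨i, hx⟩
    simp only [θ'', dif_pos hx']
    rw [hlin.arg_unique hx'.choose_spec hx]
  refine ⟨W, hW0, e', ρ', θ'', ?_, ?_, ?_, ?_, ?_⟩
  · intro p hp q hq hpq hpre
    obtain ⟨i, p, hp', rfl⟩ := (hW p).1 hp
    obtain ⟨j, q, hq', rfl⟩ := (hW q).1 hq
    rw [List.cons_prefix_cons, Fin.val_inj] at hpre
    obtain ⟨rfl, hpre⟩ := hpre
    exact hpar i p hp' q hq' (fun h => hpq (h ▸ rfl)) hpre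
  · intro p hp
    obtain ⟨i, p, hp', rfl⟩ := (hW p).1 hp
    obtain ⟨h₁, s, h₂, h₃⟩ := he i p hp'
    rw [he', hρ']
    exact ⟨h₁, s, by rwa [subtermAt_func_cons], h₃⟩
  · intro x
    by_cases hx : ∃ i, x ∈ vars (ls i)
    · obtain ⟨i, hi⟩ := hx
      rw [hθ'' i x hi]
      exact hθ' i x
    · simp only [θ'', dif_neg hx]
      exact .refl _ _ _
  · rintro x ⟨p, hp, s, hs, hx⟩
    obtain ⟨i, p, hp', rfl⟩ := (hW p).1 hp
    rw [subtermAt_func_cons] at hs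
    rw [hθ'' i x (vars_subset_of_subtermAt hs hx)]
    exact hX i x ⟨p, hp', s, hs, hx⟩
  · simp only [Term.subst]
    rw [replaceAt_func _ _ _ hW0]
    congr 1
    funext i
    rw [harg, ht i, subst_congr (hθ'' i)]
    exact replaceAt_congr _ fun p _ => by rw [he', hρ']

theorem ParStep.overlapStep {R : Set (Equation L V)} {l t : L.Term V} {θ : V → L.Term V}
    (hlin : LinearTerm l) (h : ParStep R Set.univ (l.subst θ) t) :
    ∃ U, OverlapStep R l θ t U := by
  classical
  induction l generalizing t with
  | var x =>
    have hE : ∀ e : Pos → Equation L V, OverlapStep R (.var x) θ t ∅ := fun e =>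
      ⟨e, fun _ => θ, Function.update θ x t, by simp [ParallelPos], by simp, fun y => by
        by_cases hy : y = x
        · subst hy; simpa using h
        · simpa [Function.update_of_ne hy] using ParStep.refl _ _ _,
        by simp [varsAt], by simp [replaceAt_empty, Term.subst]⟩
    exact ⟨∅, hE fun _ => ⟨t, t⟩⟩
  | @func n f ls ih =>
    generalize hs : (Term.func f ls).subst θ = s at h
    cases h with
    | @root e he ρ _ =>
      refine ⟨{[]}, fun _ => e, fun _ => ρ, θ, by simp [ParallelPos], ?_, fun x => .refl _ _ _,
        fun _ _ => rfl, by rw [replaceAt_root _ _ (by simp)]⟩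
      intro p hp
      rw [Finset.mem_singleton] at hp
      subst hp
      exact ⟨he, _, subtermAt_nil _, by simp, hs⟩
    | var x => simp [Term.subst] at hs
    | @func m g us us' hu =>
      simp only [Term.subst, Term.func.injEq] at hs
      obtain ⟨rfl, hs⟩ := hs
      simp only [heq_eq_eq] at hs
      obtain ⟨rfl, rfl⟩ := hs
      obtain ⟨U, -, hU⟩ := OverlapStep.func hlin fun i => ih i (hlin.arg i) (hu i)
      exact ⟨U, hU⟩

/-! ### Critical pairs -/

theorem Equation.IsRule.rename {e : Equation L V} (h : e.IsRule) (π : Equiv.Perm V) :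
    TermRewriting.vars (e.rename π).rhs ⊆ TermRewriting.vars (e.rename π).lhs := by
  intro x hx
  obtain ⟨y, hy, rfl⟩ := mem_vars_relabel.1 hx
  exact mem_vars_relabel.2 ⟨y, h.2 hy, rfl⟩

/-- Root peaks: the inner step takes place in the substitution, both steps coincide, or the peak is
an instance of a critical pair. -/
theorem Step.root_peak [Infinite V] {R Q : Set (Equation L V)} (hR : ∀ e ∈ R, e.IsRule)
    {e₂ : Equation L V} (he₂ : e₂ ∈ Q) {θ : V → L.Term V} {s : L.Term V}
    (h : Step R (e₂.lhs.subst θ) s) :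
    (∃ θ', (∀ x, Relation.ReflTransGen (Step R) (θ x) (θ' x)) ∧
      Relation.ReflTransGen (Step R) s (e₂.lhs.subst θ')) ∨
    s = e₂.rhs.subst θ ∨
    ∃ u v τ, IsCriticalPair R Q u v ∧ s = u.subst τ ∧ e₂.rhs.subst θ = v.subst τ := by
  classical
  rcases h.decompose with h | ⟨p, s', e, ρ, he, hp, hs', heq, hs⟩
  · exact Or.inl h
  right
  obtain ⟨π, hπ⟩ := exists_perm_disjoint e.finite_vars e₂.finite_vars
  rw [← Equation.vars_rename] at hπ
  set e₁ := e.rename π with he₁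
  -- As the renamed rule shares no variable with `e₂`, the two matching substitutions combine into
  -- one unifier.
  let τ : V → L.Term V := fun x => if x ∈ e₁.vars then ρ (π.symm x) else θ x
  have hτ₁ : ∀ y ∈ e.vars, τ (π y) = ρ y := by
    intro y hy
    have : π y ∈ e₁.vars := by rw [he₁, Equation.vars_rename]; exact ⟨y, hy, rfl⟩
    simp [τ, this]
  have hτ₂ : ∀ x ∈ e₂.vars, τ x = θ x := by
    intro x hx
    have : x ∉ e₁.vars := fun h => Set.disjoint_left.1 hπ h hx
    simp [τ, this]
  have hl₁ : e₁.lhs.subst τ = e.lhs.subst ρ := by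
    rw [he₁, Equation.rename, relabel_subst]
    exact subst_congr fun y hy => hτ₁ y (Or.inl hy)
  have hr₁ : e₁.rhs.subst τ = e.rhs.subst ρ := by
    rw [he₁, Equation.rename, relabel_subst]
    exact subst_congr fun y hy => hτ₁ y (Or.inr hy)
  have hl₂ : e₂.lhs.subst τ = e₂.lhs.subst θ := subst_congr fun y hy => hτ₂ y (Or.inl hy)
  have hr₂ : e₂.rhs.subst τ = e₂.rhs.subst θ := subst_congr fun y hy => hτ₂ y (Or.inr hy)
  have hs'τ : s'.subst τ = s'.subst θ :=
    subst_congr fun y hy => hτ₂ y (Or.inl (vars_subset_of_subtermAt hp hy))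
  -- The overlap excluded from critical pairs yields equal reducts: matching the common redex fixes
  -- the substitution on the variables of the left-hand side, and the right-hand side has no others.
  by_cases hroot : e₁.Variant e₂ ∧ p = []
  · left
    obtain ⟨⟨ξ, hξl, hξr⟩, rfl⟩ := hroot
    rw [subtermAt_nil, Option.some.injEq] at hp
    subst hp
    rw [hs, replaceAt_root _ _ (by simp), ← hr₁, hξr, relabel_subst]
    rw [← hl₁, hξl, relabel_subst] at heq
    exact subst_congr fun x hx => (eq_of_subst_eq heq (Equation.IsRule.rename (hR e he) π hx)).symm
  · right
    have hu : Unifies τ {(⟨e₁.lhs, s'⟩ : Equation L V)} := by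
      rintro _ rfl
      simp only [hl₁, hs'τ, heq]
    obtain ⟨σ, hσ⟩ := exists_strongMGU (Set.finite_singleton _) hu
    have hστ : ∀ t : L.Term V, (σ.app t).subst τ = t.subst τ := by
      intro t
      rw [Subst.app, subst_subst]
      exact subst_congr fun x _ => hσ.factor τ hu x
    refine ⟨_, _, τ, ⟨e₁, e₂, p, s', σ, ⟨e, he, e.variant_rename π⟩, .of_mem he₂, hπ, hroot, hp,
      hs', hσ.isMGU, rfl, rfl⟩, ?_, ?_⟩
    · rw [hστ, replaceAt_subst _ _ _ _ (by simpa using ⟨s', hp⟩), hs, hl₂, hr₁]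
    · rw [hστ, hr₂]

/-- Parallel steps below the root of an instance of a linear left-hand side take place in the
substitution or stem from an inner parallel critical pair. -/
theorem ParStep.root_peak [Infinite V] {R Q : Set (Equation L V)} {e₀ : Equation L V}
    (he₀ : e₀ ∈ Q) (hrule : e₀.IsRule) (hlin : LinearTerm e₀.lhs) {θ : V → L.Term V} {n : ℕ}
    {f : L.Functions n} {us ts : Fin n → L.Term V} (hl : e₀.lhs.subst θ = .func f us)
    (h : ∀ i, ParStep R Set.univ (us i) (ts i)) :
    (∃ θ', (∀ x, ParStep R Set.univ (θ x) (θ' x)) ∧ .func f ts = e₀.lhs.subst θ') ∨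
    ∃ u v X τ τ', IsInnerPCP R Q u v X ∧ (∀ x, ParStep R Set.univ (τ x) (τ' x)) ∧
      (∀ x ∈ X, τ' x = τ x) ∧ e₀.rhs.subst θ = v.subst τ ∧ .func f ts = u.subst τ' := by
  classical
  obtain ⟨U, hU0, e, ρ, θ', hpar, he, hθ', hX, ht⟩ :
      ∃ U, [] ∉ U ∧ OverlapStep R e₀.lhs θ (.func f ts) U := by
    obtain ⟨l, r⟩ := e₀
    cases l with
    | var x => exact absurd rfl (hrule.1 x)
    | @func m g ls =>
      simp only [Term.subst, Term.func.injEq] at hl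
      obtain ⟨rfl, hl⟩ := hl
      simp only [heq_eq_eq] at hl
      obtain ⟨rfl, rfl⟩ := hl
      exact OverlapStep.func hlin fun i => ParStep.overlapStep (hlin.arg i) (h i)
  rcases U.eq_empty_or_nonempty with rfl | hne
  · exact Or.inl ⟨θ', hθ', by rw [ht, replaceAt_empty]⟩
  right
  obtain ⟨π, hπ, hππ⟩ := exists_perms_disjoint U (fun p => (e p).vars)
    (fun p => (e p).finite_vars) e₀.finite_vars
  let e' : Pos → Equation L V := fun p => (e p).rename (π p)
  have hev : ∀ p, π p '' (e p).vars = (e' p).vars := fun p => (Equation.vars_rename _ _).symm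
  simp only [hev] at hπ hππ
  -- `ext η` acts as the matching substitutions on the renamed inner rules and as `η` elsewhere. It
  -- is used for both `θ` and `θ'`.
  let ext (η : V → L.Term V) : V → L.Term V := fun x =>
    if hx : ∃ p ∈ U, x ∈ (e' p).vars then ρ hx.choose ((π hx.choose).symm x) else η x
  have ext₁ : ∀ η, ∀ p ∈ U, ∀ x ∈ (e' p).vars, ext η x = ρ p ((π p).symm x) := by
    intro η p hp x hx
    have hx' : ∃ p ∈ U, x ∈ (e' p).vars := ⟨p, hp, hx⟩
    have : hx'.choose = p := by
      by_contra hne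
      exact Set.disjoint_left.1 (hππ _ hx'.choose_spec.1 p hp hne) hx'.choose_spec.2 hx
    simp only [ext, dif_pos hx', this]
  have ext₂ : ∀ η, ∀ x, (∀ p ∈ U, x ∉ (e' p).vars) → ext η x = η x := by
    intro η x hx
    have hx' : ¬ ∃ p ∈ U, x ∈ (e' p).vars := fun ⟨p, hp, h⟩ => hx p hp h
    simp only [ext, dif_neg hx']
  have ext₃ : ∀ η, ∀ x ∈ e₀.vars, ext η x = η x := fun η x hx =>
    ext₂ η x fun p hp h => Set.disjoint_left.1 (hπ p hp) h hx
  have ext₄ : ∀ η, ∀ p ∈ U, ∀ y ∈ (e p).vars, ext η (π p y) = ρ p y := by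
    intro η p hp y hy
    rw [ext₁ η p hp _ (hev p ▸ ⟨y, hy, rfl⟩), Equiv.symm_apply_apply]
  have hlhs : ∀ η, ∀ p ∈ U, (e' p).lhs.subst (ext η) = (e p).lhs.subst (ρ p) := by
    intro η p hp
    simp only [e', Equation.rename, relabel_subst]
    exact subst_congr fun y hy => ext₄ η p hp y (Or.inl hy)
  have hrhs : ∀ η, ∀ p ∈ U, (e' p).rhs.subst (ext η) = (e p).rhs.subst (ρ p) := by
    intro η p hp
    simp only [e', Equation.rename, relabel_subst]
    exact subst_congr fun y hy => ext₄ η p hp y (Or.inr hy)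
  set E : Set (Equation L V) :=
    {d | ∃ p ∈ U, d.lhs = (e' p).lhs ∧ subtermAt e₀.lhs p = some d.rhs} with hE
  have hEfin : E.Finite := by
    refine (U.finite_toSet.image
      fun p => (⟨(e' p).lhs, (subtermAt e₀.lhs p).getD e₀.lhs⟩ : Equation L V)).subset ?_
    rintro d ⟨p, hp, h₁, h₂⟩
    exact ⟨p, hp, by ext1 <;> simp [h₁, h₂]⟩
  have hEv : eqsVars E ⊆ {x | ∃ p ∈ U, x ∈ (e' p).vars} ∪ varsAt e₀.lhs U := by
    rintro x ⟨d, ⟨p, hp, h₁, h₂⟩, hx | hx⟩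
    · exact Or.inl ⟨p, hp, Or.inl (h₁ ▸ hx)⟩
    · exact Or.inr ⟨p, hp, _, h₂, hx⟩
  have hvE : varsAt e₀.lhs U ⊆ eqsVars E := by
    rintro x ⟨p, hp, s, hs, hx⟩
    exact ⟨⟨(e' p).lhs, s⟩, ⟨p, hp, rfl, hs⟩, Or.inr hx⟩
  have hvars₀ : varsAt e₀.lhs U ⊆ e₀.vars := by
    rintro x ⟨p, hp, s, hs, hx⟩
    exact Or.inl (vars_subset_of_subtermAt hs hx)
  -- Both substitutions agree on all variables of the unification problem, because `θ'` leaves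
  -- untouched whatever lies below `U`.
  have hagree : ∀ x ∈ eqsVars E, ext θ' x = ext θ x := by
    intro x hx
    rcases hEv hx with ⟨p, hp, hx⟩ | hx
    · rw [ext₁ _ p hp x hx, ext₁ _ p hp x hx]
    · rw [ext₃ _ x (hvars₀ hx), ext₃ _ x (hvars₀ hx), hX x hx]
  have hunif : Unifies (ext θ) E := by
    rintro d ⟨p, hp, h₁, h₂⟩
    obtain ⟨-, s, hs, -, hseq⟩ := he p hp
    rw [h₂, Option.some.injEq] at hs
    rw [h₁, hlhs _ p hp, ← hseq, hs]
    exact subst_congr fun x hx =>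
      (ext₃ _ x (Or.inl (vars_subset_of_subtermAt h₂ (hs ▸ hx)))).symm
  obtain ⟨σ, hσ⟩ := exists_strongMGU hEfin hunif
  have hσ₁ : ∀ t : L.Term V, (σ.app t).subst (ext θ) = t.subst (ext θ) := by
    intro t
    rw [Subst.app, subst_subst]
    exact subst_congr fun x _ => hσ.factor _ hunif x
  -- `σ` maps variables of `E` to terms over such variables, where the two substitutions agree, and
  -- is the identity elsewhere. So the same `σ` factors `ext θ'` too.
  have hσ₂ : ∀ t : L.Term V, (σ.app t).subst (ext θ') = t.subst (ext θ') := by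
    intro t
    rw [Subst.app, subst_subst]
    refine subst_congr fun x _ => ?_
    by_cases hx : x ∈ eqsVars E
    · rw [subst_congr fun y hy => hagree y (hσ.range x hx hy), hσ.factor _ hunif x, hagree x hx]
    · rw [hσ.dom x hx]; rfl
  have hposU : ∀ p ∈ U, ∃ s, subtermAt e₀.lhs p = some s := fun p hp =>
    let ⟨_, s, hs, _⟩ := he p hp
    ⟨s, hs⟩
  refine ⟨_, _, _, ext θ, ext θ', ⟨U, fun p hp h => hU0 (h ▸ hp), hne, hpar, e', e₀, σ,
    fun p hp => ⟨e p, (he p hp).1, Equation.variant_rename _ _⟩, .of_mem he₀, hπ, hππ,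
    fun h => hU0 (by simp [h.1]), fun p hp => ?_, hσ.isMGU, rfl, rfl, rfl⟩, ?_, ?_, ?_, ?_⟩
  · obtain ⟨-, s, hs, hnv, -⟩ := he p hp
    exact ⟨s, hs, hnv⟩
  · intro x
    by_cases hx : ∃ p ∈ U, x ∈ (e' p).vars
    · obtain ⟨p, hp, hx⟩ := hx
      rw [ext₁ _ p hp x hx, ext₁ _ p hp x hx]
      exact .refl _ _ _
    · push Not at hx
      rw [ext₂ _ x hx, ext₂ _ x hx]
      exact hθ' x
  · rintro x ⟨p, hp, s, hs, hx⟩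
    obtain ⟨s₀, hs₀⟩ := hposU p hp
    have := subtermAt_subst hs₀ σ.toFun
    rw [Subst.app, this, Option.some.injEq] at hs
    subst hs
    obtain ⟨z, hz, hxz⟩ := mem_vars_subst.1 hx
    exact hagree x (hσ.range z (hvE ⟨p, hp, s₀, hs₀, hz⟩) hxz)
  · rw [hσ₁]
    exact subst_congr fun x hx => (ext₃ θ x (Or.inr hx)).symm
  · rw [hσ₂, replaceAt_subst _ _ _ _ hposU, ht,
      subst_congr fun x hx => ext₃ θ' x (Or.inl hx)]
    exact replaceAt_congr _ fun p hp => (hrhs _ p hp).symm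

/-! ### Local peaks -/

open Relation in
/-- Peaks of two `S`-steps. -/
theorem Step.local_peak [Infinite V] {S T E : Set (Equation L V)} (hST : S ⊆ T)
    (hS : ∀ e ∈ S, e.IsRule) (hE : ∀ e ∈ E, e.swap ∈ E)
    (hcp : ∀ s t : L.Term V, IsCriticalPair S S s t → ∃ s' t', ReflTransGen (Step T) s s' ∧
      ParStep E Set.univ t' s' ∧ ReflTransGen (Step T) t t')
    {a s t : L.Term V} (hs : Step S a s) (ht : Step S a t) :
    ∃ s' t', ReflTransGen (Step T) s s' ∧ ReflTransGen (Step T) t t' ∧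
      ParStep E Set.univ s' t' := by
  have mono : ∀ {x y : L.Term V}, ReflTransGen (Step S) x y → ReflTransGen (Step T) x y :=
    fun h => ReflTransGen.mono (fun _ _ => Step.mono hST) _ _ h
  -- A root step on either side of the peak is covered, since the conclusion is symmetric.
  have root : ∀ {e : Equation L V}, e ∈ S → ∀ (θ : V → L.Term V) {s : L.Term V},
      Step S (e.lhs.subst θ) s → ∃ s' t', ReflTransGen (Step T) s s' ∧
      ReflTransGen (Step T) (e.rhs.subst θ) t' ∧ ParStep E Set.univ s' t' := by
    intro e he θ s hs
    rcases hs.root_peak hS he with ⟨θ', hθ', h⟩ | rfl | ⟨u, v, τ, huv, rfl, hv⟩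
    · exact ⟨_, _, (mono h).tail ((Step.root he θ').mono hST),
        mono (reflTransGen_subst_right _ hθ'), .refl _ _ _⟩
    · exact ⟨_, _, .refl, .refl, .refl _ _ _⟩
    · obtain ⟨s', t', h₁, h₂, h₃⟩ := hcp u v huv
      rw [hv]
      exact ⟨_, _, reflTransGen_subst h₁ τ, reflTransGen_subst h₃ τ,
        (h₂.symm hE).subst (fun _ => .refl _ _ _) fun _ _ => rfl⟩
  induction hs generalizing t with
  | root he θ =>
    obtain ⟨s', t', h₁, h₂, h₃⟩ := root he θ ht
    exact ⟨t', s', h₂, h₁, h₃.symm hE⟩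
  | @arg n f ts i v hv ih =>
    generalize hb : Term.func f ts = b at ht
    cases ht with
    | @root e he θ => exact root he θ (hb ▸ Step.arg f ts i hv)
    | @arg m g us j v' hv' =>
      simp only [Term.func.injEq] at hb
      obtain ⟨rfl, hb⟩ := hb
      simp only [heq_eq_eq] at hb
      obtain ⟨rfl, rfl⟩ := hb
      by_cases hij : i = j
      · subst hij
        obtain ⟨s', t', h₁, h₂, h₃⟩ := ih hv'
        refine ⟨_, _, reflTransGen_arg f ts i h₁, reflTransGen_arg f ts i h₂, .func f fun k => ?_⟩
        by_cases hk : k = i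
        · subst hk; simpa using h₃
        · simpa [Function.update_of_ne hk] using ParStep.refl _ _ _
      · refine ⟨_, _, .single ((Step.arg f (Function.update ts i v) j (v := v') ?_).mono hST),
          .single ((Step.arg f (Function.update ts j v') i (v := v) ?_).mono hST), ?_⟩
        · simpa [Function.update_of_ne (Ne.symm hij)] using hv'
        · simpa [Function.update_of_ne hij] using hv
        · rw [Function.update_comm hij]
          exact .refl _ _ _

open Relation in
/-- Peaks of a parallel `E`-step and an `S`-step. -/
theorem ParStep.local_peak [Infinite V] {S T E : Set (Equation L V)} (hST : S ⊆ T)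
    (hS : ∀ e ∈ S, e.IsRule) (hlin : LeftLinear S) (hE : ∀ e ∈ E, e.swap ∈ E)
    (hpcp : ∀ (s t : L.Term V) (X : Set V), IsInnerPCP E S s t X → ∃ s' t' : L.Term V,
      (s = s' ∨ ∃ s₁, Step S s s₁ ∧ ReflTransGen (Step T) s₁ s') ∧
      ParStep E X t' s' ∧ ReflTransGen (Step T) t t')
    (hcp : ∀ s t : L.Term V, IsCriticalPair S E s t →
      (∃ s', ReflTransGen (Step T) s s' ∧ ParStep E Set.univ s' t) ∨
      (∃ s' t' t₁, ReflTransGen (Step T) s s' ∧ ParStep E Set.univ s' t' ∧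
        ReflTransGen (Step T) t₁ t' ∧ Step S t t₁))
    {a s t : L.Term V} (ht : ParStep E Set.univ a t) (hs : Step S a s) :
    ∃ s' t', ReflTransGen (Step T) s s' ∧
      (t = t' ∨ ∃ t₁, Step S t t₁ ∧ ReflTransGen (Step T) t₁ t') ∧
      ParStep E Set.univ t' s' := by
  have mono : ∀ {x y : L.Term V}, ReflTransGen (Step S) x y → ReflTransGen (Step T) x y :=
    fun h => ReflTransGen.mono (fun _ _ => Step.mono hST) _ _ h
  have subst' : ∀ {x y : L.Term V} (τ : V → L.Term V),
      (x = y ∨ ∃ t₁, Step S x t₁ ∧ ReflTransGen (Step T) t₁ y) →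
      (x.subst τ = y.subst τ ∨
        ∃ t₁, Step S (x.subst τ) t₁ ∧ ReflTransGen (Step T) t₁ (y.subst τ)) := by
    rintro x y τ (rfl | ⟨t₁, h₁, h₂⟩)
    · exact Or.inl rfl
    · exact Or.inr ⟨_, h₁.subst τ, reflTransGen_subst h₂ τ⟩
  induction ht generalizing s with
  | @root e he θ _ =>
    rcases hs.root_peak hS he with ⟨θ', hθ', h⟩ | rfl | ⟨u, v, τ, huv, rfl, hv⟩
    · refine ⟨_, e.rhs.subst θ', mono h, ?_, (ParStep.root he θ' (Set.subset_univ _)).symm hE⟩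
      -- This reduction consists of `S`-steps only, so it is empty or begins with the required
      -- `S`-step.
      rcases (reflTransGen_subst_right e.rhs hθ').cases_head with h | ⟨c, h₁, h₂⟩
      · exact Or.inl h
      · exact Or.inr ⟨c, h₁, mono h₂⟩
    · exact ⟨_, _, .refl, Or.inl rfl, .refl _ _ _⟩
    · rw [hv]
      have par : ∀ {x y : L.Term V}, ParStep E Set.univ x y →
          ParStep E Set.univ (y.subst τ) (x.subst τ) := fun h =>
        (h.symm hE).subst (fun _ => .refl _ _ _) fun _ _ => rfl
      rcases hcp u v huv with ⟨s', h₁, h₂⟩ | ⟨s', t', t₁, h₁, h₂, h₃, h₄⟩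
      · exact ⟨_, _, reflTransGen_subst h₁ τ, Or.inl rfl, par h₂⟩
      · exact ⟨_, _, reflTransGen_subst h₁ τ, subst' τ (Or.inr ⟨t₁, h₄, h₃⟩), par h₂⟩
  | var x =>
    generalize hb : (Term.var x : L.Term V) = b at hs
    cases hs with
    | @root e he θ =>
      obtain ⟨l, r⟩ := e
      cases l with
      | var y => exact absurd rfl ((hS _ he).1 y)
      | func f ts => simp [Term.subst] at hb
    | arg => cases hb
  | @func n f us ts h ih =>
    generalize hb : Term.func f us = b at hs
    cases hs with
    | @root e he θ =>
      rcases ParStep.root_peak he (hS e he) (hlin e he) hb.symm h with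
        ⟨θ', hθ', ht⟩ | ⟨u, v, X, τ, τ', huv, hτ, hX, hv, hu⟩
      · refine ⟨_, e.rhs.subst θ', .refl, Or.inr ⟨_, ?_, .refl⟩, ?_⟩
        · rw [ht]; exact .root he θ'
        -- With the bound `∅` nothing in `e.rhs` is contracted, so all copies of the variables can
        -- move from `θ` to `θ'` in a single parallel step.
        · exact ((ParStep.refl E ∅ e.rhs).subst hθ' (by simp)).symm hE
      · obtain ⟨s', t', h₁, h₂, h₃⟩ := hpcp u v X huv
        rw [hv, hu]
        exact ⟨_, _, reflTransGen_subst h₃ τ, subst' τ' h₁, (h₂.subst hτ hX).symm hE⟩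
    | @arg m g us' i v hv =>
      simp only [Term.func.injEq] at hb
      obtain ⟨rfl, hb⟩ := hb
      simp only [heq_eq_eq] at hb
      obtain ⟨rfl, rfl⟩ := hb
      obtain ⟨s', t', h₁, h₂, h₃⟩ := ih i hv
      refine ⟨_, .func f (Function.update ts i t'), reflTransGen_arg f us i h₁, ?_,
        .func f fun k => ?_⟩
      · rcases h₂ with rfl | ⟨t₁, h₄, h₅⟩
        · exact Or.inl (by simp)
        · exact Or.inr ⟨_, .arg f ts i h₄, reflTransGen_arg f ts i h₅⟩
      · by_cases hk : k = i
        · subst hk; simpa using h₃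
        · simpa [Function.update_of_ne hk] using (h k).symm hE

/-- Parallel steps of a reversible system and its inverse are reductions. -/
theorem ParStep.reflTransGen {P : Set (Equation L V)}
    (hrev : ∀ s t : L.Term V, Step P s t → Relation.ReflTransGen (Step P) t s) {X : Set V}
    {s t : L.Term V} (h : ParStep (P ∪ inverse P) X s t) :
    Relation.ReflTransGen (Step P) s t := by
  induction h with
  | @root e he θ _ =>
    rcases he with he | he
    · exact .single (.root he θ)
    · exact hrev _ _ (Step.root (e := e.swap) he θ)
  | var x => exact .refl
  | func f _ ih => exact reflTransGen_func f ih

/-! ### Abstract conversions modulo a symmetric relation -/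

section Abstract

open Relation

variable {A : Type*} (S H : A → A → Prop)

/-- Steps of conversions with their costs. -/
inductive CostStep : Multiset (A × Bool) → A → A → Prop
  | mod {a b : A} (h : H a b) : CostStep {(a, true), (b, true)} a b
  | fwd {a b : A} (h : S a b) : CostStep {(a, false)} a b
  | bwd {a b : A} (h : S b a) : CostStep {(b, false)} a b

/-- Conversions with their costs. -/
inductive CostConv : Multiset (A × Bool) → A → A → Prop
  | nil (a : A) : CostConv 0 a a
  | cons {m M : Multiset (A × Bool)} {a b c : A} (h : CostStep S H m a b) (h' : CostConv M b c) :
      CostConv (m + M) a c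

variable {S H}

theorem CostConv.single {m : Multiset (A × Bool)} {a b : A} (h : CostStep S H m a b) :
    CostConv S H m a b := by
  simpa using CostConv.cons h (.nil b)

theorem CostConv.append {M N : Multiset (A × Bool)} {a b c : A} (h : CostConv S H M a b)
    (h' : CostConv S H N b c) : CostConv S H (M + N) a c := by
  induction h with
  | nil => simpa using h'
  | cons h _ ih => rw [add_assoc]; exact .cons h (ih h')

theorem CostStep.symm (hH : ∀ a b, H a b → H b a) {m : Multiset (A × Bool)} {a b : A}
    (h : CostStep S H m a b) : CostStep S H m b a := by
  cases h with
  | mod h => rw [Multiset.pair_comm]; exact .mod (hH _ _ h)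
  | fwd h => exact .bwd h
  | bwd h => exact .fwd h

theorem CostConv.symm (hH : ∀ a b, H a b → H b a) {M : Multiset (A × Bool)} {a b : A}
    (h : CostConv S H M a b) : CostConv S H M b a := by
  induction h with
  | nil => exact .nil _
  | cons h _ ih => rw [add_comm]; exact ih.append (.single (h.symm hH))

/-- Replacing one element by smaller ones decreases a multiset. -/
theorem cutExpand_add {r : A × Bool → A × Bool → Prop} (K : Multiset (A × Bool))
    {N : Multiset (A × Bool)} {d : A × Bool} (h : ∀ y ∈ N, r y d) :
    CutExpand r (K + N) (K + {d}) :=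
  (cutExpand_add_left K).2 (cutExpand_singleton h)

variable {G T : A → A → Prop}

/-- The order on costs. -/
abbrev costLT (G : A → A → Prop) : A × Bool → A × Bool → Prop :=
  Prod.Lex G (· < ·)

/-- The order on multisets of costs. -/
abbrev mcostLT (G : A → A → Prop) : Multiset (A × Bool) → Multiset (A × Bool) → Prop :=
  TransGen (CutExpand (costLT G))

theorem mcostLT.add {M M' : Multiset (A × Bool)} (h : mcostLT G M M') (N : Multiset (A × Bool)) :
    mcostLT G (N + M) (N + M') := by
  induction h with
  | single h => exact .single ((cutExpand_add_left N).2 h)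
  | tail _ h ih => exact ih.tail ((cutExpand_add_left N).2 h)

theorem mcostLT.add_right {M M' : Multiset (A × Bool)} (h : mcostLT G M M')
    (N : Multiset (A × Bool)) : mcostLT G (M + N) (M' + N) := by
  rw [add_comm M, add_comm M']; exact h.add N

theorem wellFounded_mcostLT (hG : WellFounded G) : WellFounded (mcostLT G) := by
  have hlex : WellFounded (costLT G) := WellFounded.prod_lex hG wellFounded_lt
  have : Std.Irrefl (costLT G) := ⟨fun x hx => hlex.irrefl.irrefl x hx⟩
  exact hlex.cutExpand.transGen

/-- Reductions from a descendant of `w` have only costs below `w`. -/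
theorem exists_costConv (hT : ∀ a b, T a b → S a b ∨ H a b)
    (hG : ∀ a b c, G a c → T a b → G b c) {w a b : A} (hw : G a w)
    (h : ReflTransGen T a b) :
    G b w ∧ ∃ M, CostConv S H M a b ∧ ∀ y ∈ M, G y.1 w := by
  induction h with
  | refl => exact ⟨hw, 0, .nil _, by simp⟩
  | @tail b c _ hbc ih =>
    obtain ⟨hb, M, hM, hMw⟩ := ih
    have hc := hG _ _ _ hb hbc
    rcases hT _ _ hbc with h | h
    · exact ⟨hc, _, hM.append (.single (.fwd h)), by
        simp only [Multiset.mem_add, Multiset.mem_singleton]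
        rintro y (hy | rfl)
        exacts [hMw y hy, hb]⟩
    · exact ⟨hc, _, hM.append (.single (.mod h)), by
        simp only [Multiset.mem_add, Multiset.insert_eq_cons, Multiset.mem_cons,
          Multiset.mem_singleton]
        rintro y (hy | rfl | rfl)
        exacts [hMw y hy, hb, hc]⟩

/-- Conversions of the shape `←*_S`, with their costs. -/
inductive Down (S : A → A → Prop) : Multiset (A × Bool) → A → A → Prop
  | nil (a : A) : Down S 0 a a
  | cons {M : Multiset (A × Bool)} {a b c : A} (h : S b a) (h' : Down S M b c) :
      Down S ({(b, false)} + M) a c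

/-- Conversions of the shape `↔*_H ∘ ←*_S`. -/
inductive Mid (S H : A → A → Prop) : Multiset (A × Bool) → A → A → Prop
  | down {M : Multiset (A × Bool)} {a b : A} (h : Down S M a b) : Mid S H M a b
  | cons {M : Multiset (A × Bool)} {a b c : A} (h : H a b) (h' : Mid S H M b c) :
      Mid S H ({(a, true), (b, true)} + M) a c

/-- Conversions of the shape `→*_S ∘ ↔*_H ∘ ←*_S`. -/
inductive Valley (S H : A → A → Prop) : Multiset (A × Bool) → A → A → Prop
  | mid {M : Multiset (A × Bool)} {a b : A} (h : Mid S H M a b) : Valley S H M a b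
  | cons {M : Multiset (A × Bool)} {a b c : A} (h : S a b) (h' : Valley S H M b c) :
      Valley S H ({(a, false)} + M) a c

theorem Down.costConv {M : Multiset (A × Bool)} {a b : A} (h : Down S M a b) :
    CostConv S H M a b := by
  induction h with
  | nil => exact .nil _
  | cons h _ ih => exact .cons (.bwd h) ih

theorem Mid.costConv {M : Multiset (A × Bool)} {a b : A} (h : Mid S H M a b) :
    CostConv S H M a b := by
  induction h with
  | down h => exact h.costConv
  | cons h _ ih => exact .cons (.mod h) ih

theorem Valley.costConv {M : Multiset (A × Bool)} {a b : A} (h : Valley S H M a b) :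
    CostConv S H M a b := by
  induction h with
  | mid h => exact h.costConv
  | cons h _ ih => exact .cons (.fwd h) ih

theorem Down.reflTransGen {M : Multiset (A × Bool)} {a b : A} (h : Down S M a b) :
    ReflTransGen S b a := by
  induction h with
  | nil => exact .refl
  | cons h _ ih => exact ih.tail h

theorem Mid.reflTransGen {M : Multiset (A × Bool)} {a b : A} (h : Mid S H M a b) :
    ∃ d, ReflTransGen H a d ∧ ReflTransGen S b d := by
  induction h with
  | down h => exact ⟨_, .refl, h.reflTransGen⟩
  | cons h _ ih =>
    obtain ⟨d, h₁, h₂⟩ := ih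
    exact ⟨d, h₁.head h, h₂⟩

theorem Valley.reflTransGen {M : Multiset (A × Bool)} {a b : A} (h : Valley S H M a b) :
    ∃ c d, ReflTransGen S a c ∧ ReflTransGen H c d ∧ ReflTransGen S b d := by
  induction h with
  | mid h => exact ⟨_, h.reflTransGen.choose, .refl, h.reflTransGen.choose_spec⟩
  | cons h _ ih =>
    obtain ⟨c, d, h₁, h₂⟩ := ih
    exact ⟨c, d, h₁.head h, h₂⟩

/-- A conversion that is not a valley can be replaced by a cheaper one if all local peaks can. -/
theorem CostConv.valley_or_smaller (hH : ∀ a b, H a b → H b a)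
    (peakS : ∀ a s t, S a s → S a t →
      ∃ M, CostConv S H M s t ∧ mcostLT G M ({(a, false)} + {(a, false)}))
    (peakH : ∀ a s t, H t a → S a s →
      ∃ M, CostConv S H M t s ∧ mcostLT G M ({(t, true), (a, true)} + {(a, false)}))
    {M : Multiset (A × Bool)} {a b : A} (h : CostConv S H M a b) :
    Valley S H M a b ∨ ∃ M', CostConv S H M' a b ∧ mcostLT G M' M := by
  induction h with
  | nil a => exact Or.inl (.mid (.down (.nil a)))
  | @cons m M a b c h _ ih =>
    rcases ih with ih | ⟨M', hM', hlt⟩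
    -- Prepending a step to a valley creates at most one peak, formed with the first step of the
    -- valley. Its replacement lowers the total cost while the rest is kept.
    · have replace : ∀ {m' M₁ : Multiset (A × Bool)} {b' : A},
          (∃ N, CostConv S H N a b' ∧ mcostLT G N (m + m')) → CostConv S H M₁ b' c →
          ∃ M', CostConv S H M' a c ∧ mcostLT G M' (m + (m' + M₁)) := by
        rintro m' M₁ b' ⟨N, hN, hlt⟩ h₁
        exact ⟨_, hN.append h₁, by rw [← add_assoc]; exact hlt.add_right M₁⟩
      cases h with
      | fwd h => exact Or.inl (.cons h ih)
      | mod h =>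
        cases ih with
        | mid ih => exact Or.inl (.mid (.cons h ih))
        | cons h₁ ih => exact Or.inr (replace (peakH _ _ _ h h₁) ih.costConv)
      | bwd h =>
        cases ih with
        | cons h₁ ih => exact Or.inr (replace (peakS _ _ _ h h₁) ih.costConv)
        | mid ih =>
          cases ih with
          | down ih => exact Or.inl (.mid (.down (.cons h ih)))
          | @cons M _ b' _ h₁ ih =>
            refine Or.inr (replace ?_ ih.costConv)
            obtain ⟨N, hN, hlt⟩ := peakH _ _ _ (hH _ _ h₁) h
            refine ⟨N, hN.symm hH, ?_⟩
            rwa [add_comm, Multiset.pair_comm]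
    · exact Or.inr ⟨_, .cons h hM', hlt.add m⟩

/-- Church-Rosser modulo a symmetric relation `H` from local peak conditions. -/
theorem CostConv.exists_valley (hH : ∀ a b, H a b → H b a) (hT : ∀ a b, T a b → S a b ∨ H a b)
    (hGwf : WellFounded G) (hSG : ∀ a b, S a b → G b a)
    (hG : ∀ a b c, G a c → T a b → G b c)
    (peakS : ∀ a s t, S a s → S a t →
      ∃ s' t', ReflTransGen T s s' ∧ ReflTransGen T t t' ∧ H s' t')
    (peakH : ∀ a s t, H a t → S a s →
      ∃ s' t', ReflTransGen T s s' ∧ (t = t' ∨ ∃ t₁, S t t₁ ∧ ReflTransGen T t₁ t') ∧ H t' s')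
    {M : Multiset (A × Bool)} {a b : A} (h : CostConv S H M a b) :
    ∃ c d, ReflTransGen S a c ∧ ReflTransGen H c d ∧ ReflTransGen S b d := by
  have lt_of : ∀ {a : A} {k : Bool} {N : Multiset (A × Bool)}, (∀ y ∈ N, G y.1 a) →
      ∀ y ∈ N, costLT G y (a, k) := fun h y hy => Prod.Lex.left _ _ (h y hy)
  have peakS' : ∀ a s t, S a s → S a t →
      ∃ M, CostConv S H M s t ∧ mcostLT G M ({(a, false)} + {(a, false)}) := by
    intro a s t hs ht
    obtain ⟨s', t', h₁, h₂, h₃⟩ := peakS a s t hs ht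
    obtain ⟨hs', M₁, hM₁, hlt₁⟩ := exists_costConv hT hG (hSG _ _ hs) h₁
    obtain ⟨ht', M₂, hM₂, hlt₂⟩ := exists_costConv hT hG (hSG _ _ ht) h₂
    refine ⟨_, (hM₁.append (.single (.mod h₃))).append (hM₂.symm hH), ?_⟩
    have hN : ∀ y ∈ M₁ + {(s', true), (t', true)} + M₂, G y.1 a := by
      simp only [Multiset.mem_add, Multiset.insert_eq_cons, Multiset.mem_cons,
        Multiset.mem_singleton]
      rintro y ((hy | rfl | rfl) | hy)
      exacts [hlt₁ y hy, hs', ht', hlt₂ y hy]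
    -- One copy of `(a, false)` pays for the whole new conversion, the other is discarded.
    refine TransGen.head (b := {(a, false)}) (cutExpand_singleton (lt_of hN)) (.single ?_)
    simpa using cutExpand_add {(a, false)} (N := 0) (d := (a, false)) (r := costLT G) (by simp)
  have peakH' : ∀ a s t, H t a → S a s →
      ∃ M, CostConv S H M t s ∧ mcostLT G M ({(t, true), (a, true)} + {(a, false)}) := by
    intro a s t ht hs
    obtain ⟨s', t', h₁, h₂, h₃⟩ := peakH a s t (hH _ _ ht) hs
    obtain ⟨hs', M₁, hM₁, hlt₁⟩ := exists_costConv hT hG (hSG _ _ hs) h₁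
    have hsplit : ({(t, true), (a, true)} + {(a, false)} : Multiset (A × Bool)) =
        {(t, true)} + {(a, true)} + {(a, false)} := rfl
    have drop : CutExpand (costLT G) ({(t, true)} + {(a, true)} : Multiset (A × Bool))
        ({(t, true)} + {(a, true)} + {(a, false)}) := by
      simpa using cutExpand_add ({(t, true)} + {(a, true)}) (N := 0) (d := (a, false))
        (r := costLT G) (by simp)
    have hN : ∀ y ∈ ({(s', true)} + M₁ : Multiset (A × Bool)), G y.1 a := by
      simp only [Multiset.mem_add, Multiset.mem_singleton]
      rintro y (rfl | hy)
      exacts [hs', hlt₁ y hy]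
    -- `(a, true)` pays for everything on the side of `s`, including the end `s'` of the new H-step.
    have mainstep : CutExpand (costLT G) ({(t, true)} + ({(s', true)} + M₁))
        ({(t, true)} + {(a, true)}) := cutExpand_add _ (lt_of hN)
    rw [hsplit]
    rcases h₂ with rfl | ⟨t₁, h₄, h₅⟩
    · refine ⟨_, (CostConv.single (.mod h₃)).append (hM₁.symm hH), ?_⟩
      have : ({(t, true), (s', true)} + M₁ : Multiset (A × Bool)) =
        {(t, true)} + ({(s', true)} + M₁) := by rw [← add_assoc]; rfl
      rw [this]
      exact .head mainstep (.single drop)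
    · obtain ⟨ht', M₂, hM₂, hlt₂⟩ := exists_costConv hT hG (hSG _ _ h₄) h₅
      refine ⟨_, (((CostConv.single (.fwd h₄)).append hM₂).append
        (.single (.mod h₃))).append (hM₁.symm hH), ?_⟩
      -- The Boolean is needed here: the `S`-step out of `t` costs `(t, false)`, which is below the
      -- end `(t, true)` of the old H-step.
      have hN₂ : ∀ y ∈ ({(t, false)} + M₂ + {(t', true)} : Multiset (A × Bool)),
          costLT G y (t, true) := by
        simp only [Multiset.mem_add, Multiset.mem_singleton]
        rintro y ((rfl | hy) | rfl)
        · exact Prod.Lex.right _ (by decide)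
        · exact Prod.Lex.left _ _ (hlt₂ y hy)
        · exact Prod.Lex.left _ _ ht'
      have : ({(t, false)} + M₂ + {(t', true), (s', true)} + M₁ : Multiset (A × Bool)) =
          ({(s', true)} + M₁) + ({(t, false)} + M₂ + {(t', true)}) := by
        rw [show ({(t', true), (s', true)} : Multiset (A × Bool)) = {(t', true)} + {(s', true)}
          from rfl]
        abel
      rw [this]
      refine .head (cutExpand_add _ hN₂) ?_
      rw [add_comm _ ({(t, true)} : Multiset (A × Bool))]
      exact .head mainstep (.single drop)
  induction M using (wellFounded_mcostLT hGwf).induction with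
  | _ M ih =>
    rcases h.valley_or_smaller hH peakS' peakH' with h | ⟨M', h', hlt⟩
    · exact h.reflTransGen
    · exact ih M' hlt h'

end Abstract

end TermRewriting

/-! ### Confluence of `S ∪ P` -/

open TermRewriting
theorem theorem3p15 {L : FirstOrder.Language.{u, w}} {V : Type v} [Infinite V]
    (S P P' : Set (Equation L V)) (hS : IsTRS S) (hP : IsTRS P) (hP' : IsTRS P')
    (hlin : LeftLinear S) (hrev : Reversible P)
    (hsub : SubsetVariant P' (P ∪ inverse P))
    (hterm : RelTerminating S P')
    (h₁ : ∀ s t : L.Term V, IsCriticalPair S S s t →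
      ∃ s' t', RewStar (S ∪ P') s s' ∧ ParRew (P ∪ inverse P) t' s' ∧ RewStar (S ∪ P') t t')
    (h₂ : ∀ (s t : L.Term V) (X : Set V), IsInnerPCP (P ∪ inverse P) S s t X →
      ∃ (s' t' : L.Term V) (U : Finset Pos),
        (s = s' ∨ ∃ s₁, Rew S s s₁ ∧ RewStar (S ∪ P') s₁ s') ∧
        ParRewAt (P ∪ inverse P) U t' s' ∧ RewStar (S ∪ P') t t' ∧ varsAt s' U ⊆ X)
    (h₃ : ∀ s t : L.Term V, IsCriticalPair S (P ∪ inverse P) s t →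
      (∃ s', RewStar (S ∪ P') s s' ∧ ParRew (P ∪ inverse P) s' t) ∨
      (∃ s' t' t₁, RewStar (S ∪ P') s s' ∧ ParRew (P ∪ inverse P) s' t' ∧
        RewStar (S ∪ P') t₁ t' ∧ Rew S t t₁)) :
    Confluent (S ∪ P) := by
  simp only [Confluent, RewStar, Reversible, RelTerminating, ← step_eq_rew]
    at hrev hterm h₁ h₂ h₃ ⊢
  set E := P ∪ inverse P with hE
  have hEswap : ∀ e ∈ E, e.swap ∈ E := fun e he => Or.symm he
  have hsymm : ∀ a b : L.Term V, ParStep E Set.univ a b → ParStep E Set.univ b a :=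
    fun _ _ h => h.symm hEswap
  have step_cases : ∀ {R R' : Set (Equation L V)} {a b : L.Term V}, Step (R ∪ R') a b →
      Step R a b ∨ Step R' a b := by
    intro R R' a b h
    induction h with
    | root he θ => exact he.imp (fun he => .root he θ) fun he => .root he θ
    | arg f ts i _ ih => exact ih.imp (.arg f ts i) (.arg f ts i)
  let G₀ : L.Term V → L.Term V → Prop := fun t s =>
    ∃ s', Step S s s' ∧ Relation.ReflTransGen (Step P') s' t
  have hcr : ∀ {M : Multiset (L.Term V × Bool)} {a b : L.Term V},
      CostConv (Step S) (ParStep E Set.univ) M a b → ∃ c d,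
        Relation.ReflTransGen (Step S) a c ∧
        Relation.ReflTransGen (ParStep E Set.univ) c d ∧
        Relation.ReflTransGen (Step S) b d := by
    intro M a b h
    refine h.exists_valley (T := Step (S ∪ P')) (G := Relation.TransGen G₀) hsymm ?_
      hterm.transGen ?_ ?_ ?_ ?_
    · exact fun a b h => (step_cases h).imp_right fun h => (h.of_subsetVariant hsub).parStep
    · exact fun a b h => .single ⟨b, h, .refl⟩
    · intro a b c hac hab
      rcases step_cases hab with h | h
      · exact .head ⟨b, h, .refl⟩ hac
      -- A `P'`-step is absorbed into the tail of the last block `→_S ∘ →*_{P'}`, which exists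
      -- because the descent is nonempty.
      · rcases Relation.TransGen.head'_iff.1 hac with ⟨d, ⟨s', h₁, h₂⟩, hd⟩
        exact Relation.TransGen.head'_iff.2 ⟨d, ⟨s', h₁, h₂.tail h⟩, hd⟩
    · intro a s t hs ht
      refine hs.local_peak Set.subset_union_left hS.2 hEswap ?_ ht
      intro s t hst
      obtain ⟨s', t', h, h', h''⟩ := h₁ s t hst
      exact ⟨s', t', h, h'.parStep, h''⟩
    · intro a s t ht hs
      refine ht.local_peak Set.subset_union_left hS.2 hlin hEswap ?_ ?_ hs
      · intro s t X hst
        obtain ⟨s', t', U, h, h', h'', hX⟩ := h₂ s t X hst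
        exact ⟨s', t', h, h'.parStep hX, h''⟩
      · intro s t hst
        rcases h₃ s t hst with ⟨s', h, h'⟩ | ⟨s', t', t₁, h, h', h''⟩
        · exact Or.inl ⟨s', h, h'.parStep⟩
        · exact Or.inr ⟨s', t', t₁, h, h'.parStep, h''⟩
  have hconv : ∀ {a b : L.Term V}, Relation.ReflTransGen (Step (S ∪ P)) a b →
      ∃ M, CostConv (Step S) (ParStep E Set.univ) M a b := by
    intro a b h
    induction h with
    | refl => exact ⟨0, .nil _⟩
    | tail _ h ih =>
      obtain ⟨M, hM⟩ := ih
      rcases step_cases h with h | h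
      · exact ⟨_, hM.append (.single (.fwd h))⟩
      · exact ⟨_, hM.append (.single (.mod (h.mono Set.subset_union_left).parStep))⟩
  intro s t₁ t₂ hs₁ hs₂
  obtain ⟨M₁, hM₁⟩ := hconv hs₁
  obtain ⟨M₂, hM₂⟩ := hconv hs₂
  -- The two reductions from `s` are read as one conversion from `t₁` to `t₂`.
  obtain ⟨c, d, hc, hcd, hd⟩ := hcr ((hM₁.symm hsymm).append hM₂)
  have hS' : ∀ {a b : L.Term V}, Relation.ReflTransGen (Step S) a b →
      Relation.ReflTransGen (Step (S ∪ P)) a b :=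
    fun h => Relation.ReflTransGen.mono (fun _ _ => Step.mono Set.subset_union_left) _ _ h
  have hcd' : Relation.ReflTransGen (Step (S ∪ P)) c d := by
    clear hd
    induction hcd with
    | refl => exact .refl
    | tail _ h ih =>
      exact ih.trans (Relation.ReflTransGen.mono (fun _ _ => Step.mono Set.subset_union_right) _ _
        (h.reflTransGen hrev))
  exact ⟨d, (hS' hc).trans hcd', hS' hd⟩
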